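/- **Definitions.** Let $(X,d)$ be a metric space. A *geodesic* is a continuous map $c\colon[0,1]\to X$ with $d(c(s),c(t))=|s-t|\,d(c(0),c(1))$ for all $s,t$. A *geodesic bicombing* on $X$ is a map $\tau\colon X\times X\times[0,1]\to X$ such that each $\tau_{xy}:=\tau(x,y,\cdot)$ is a geodesic from $x$ to $y$, and $\tau_{pq}([0,1])\subset\tau_{xy}([0,1])$ whenever $p,q\in\tau_{xy}([0,1])$ and $d(x,p)\le d(x,q)$. It is *convex* if $t\mapsto d(\tau_{xy}(t),\tau_{\bar x\bar y}(t))$ is convex on $[0,1]$ for all $x,y,\bar x,\bar y\in X$, and *reversible* if $\tau_{yx}([0,1])=\tau_{xy}([0,1])$ for all $x,y\in X$. A *local geodesic bicombing* $\sigma$ on $X$ consists of radii $r_x>0$ $(x\in X)$ and, with $U(x,r):=\{y\in X: d(x,y)<r\}$ and $U:=\{(y,z)\in X\times X: y,z\in U(x,r_x)\text{ for some }x\in X\}$, of a geodesic $\sigma_{yz}\colon[0,1]\to X$ from $y$ to $z$ for each $(y,z)\in U$, such that $\sigma_{yz}([0,1])\subset U(x,r_x)$ whenever $y,z\in U(x,r_x)$,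 and $\sigma_{\sigma_{yz}(a)\sigma_{yz}(b)}(t)=\sigma_{yz}((1-t)a+tb)$ for all $(y,z)\in U$, $0\le a\le b\le1$ and $t\in[0,1]$. It is *convex* if, for every $x\in X$ and all $y,z,y',z'\in U(x,r_x)$, the function $t\mapsto d(\sigma_{yz}(t),\sigma_{y'z'}(t))$ is convex on $[0,1]$, and *reversible* if $\sigma_{zy}(t)=\sigma_{yz}(1-t)$ for all $(y,z)\in U$ and $t\in[0,1]$. A map $c\colon[0,1]\to X$ is *consistent with* $\sigma$ if $c((1-t)a+tb)=\sigma_{c(a)c(b)}(t)$ for all $t\in[0,1]$ and all $0\le a\le b\le1$ with $(c(a),c(b))\in U$. A map $\tau\colon X\times X\times[0,1]\to X$ is *consistent with* $\sigma$ if every $\tau_{xy}$ is. The *induced length metric* is $\bar d(x,y):=\inf L(\gamma)$, the infimum over all continuous $\gamma\colon[0,1]\to X$ with $\gamma(0)=x$ and $\gamma(1)=y$, where $L(\gamma)$ is the supremum of $\sum_{k=1}^n d(\gamma(t_{k-1}),\gamma(t_k))$ over all partitions $0=t_0<\dots<t_n=1$. **Theorem.** Let $X$ be a complete, simply-connected metric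 space with a convex local geodesic bicombing $\sigma$. Then $\bar d(x,y)<\infty$ for all $x,y\in X$, so that $\bar d$ is a metric on $X$, and there is exactly one convex geodesic bicombing $\tilde\sigma$ on $(X,\bar d)$ which is consistent with $\sigma$. Moreover, $X$ is contractible, and if $\sigma$ is reversible, then $\tilde\sigma$ is reversible as well. -/

import Mathlib

open Set Metric
open scoped ENNReal

noncomputable section

/-! ### Length of curves and the induced length metric -/

/-- The length of a continuous curve `γ : [0,1] → X`: the supremum of the sums
`∑ d(γ(t_{k-1}), γ(t_k))` over all finite partitions of `[0,1]`. -/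
def curveLength {X : Type*} [MetricSpace X] {x y : X} (γ : Path x y) : ℝ≥0∞ :=
  eVariationOn γ univ

/-- The infimum of the lengths of all continuous curves from `x` to `y`, with values in
`[0,∞]` (it is `∞` if there is no rectifiable curve from `x` to `y`). -/
def inducedLengthEDist {X : Type*} [MetricSpace X] (x y : X) : ℝ≥0∞ :=
  ⨅ γ : Path x y, curveLength γ

theorem edist_le_inducedLengthEDist {X : Type*} [MetricSpace X] (x y : X) :
    edist x y ≤ inducedLengthEDist x y := by
  refine le_iInf fun γ => ?_
  have h := eVariationOn.edist_le (γ : unitInterval → X) (s := univ) (mem_univ 0) (mem_univ 1)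
  rw [γ.source, γ.target] at h
  exact h

theorem inducedLengthEDist_self {X : Type*} [MetricSpace X] (x : X) :
    inducedLengthEDist x x = 0 := by
  refine le_antisymm ((iInf_le _ (Path.refl x)).trans ?_) bot_le
  refine (eVariationOn.constant_on ?_).le
  rintro _ ⟨s, -, rfl⟩ _ ⟨t, -, rfl⟩
  rfl

theorem inducedLengthEDist_comm_le {X : Type*} [MetricSpace X] (x y : X) :
    inducedLengthEDist x y ≤ inducedLengthEDist y x := by
  refine le_iInf fun γ => (iInf_le _ γ.symm).trans ?_
  refine eVariationOn.comp_le_of_antitoneOn (γ : unitInterval → X) unitInterval.symm (t := univ) ?_ (mapsTo_univ _ _)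
  intro s _ t _ hst
  exact unitInterval.symm_le_symm.2 hst

theorem curveLength_trans_le {X : Type*} [MetricSpace X] {x y z : X} (γ : Path x y)
    (δ : Path y z) : curveLength (γ.trans δ) ≤ curveLength γ + curveLength δ := by
  let h : unitInterval := ⟨1 / 2, by norm_num, by norm_num⟩
  have hu : (univ : Set unitInterval) = Iic h ∪ Ici h := by simp
  have hun : curveLength (γ.trans δ) =
      eVariationOn (γ.trans δ : unitInterval → X) (Iic h ∪ Ici h) := by
    rw [← hu]
    rfl
  rw [hun, eVariationOn.union (γ.trans δ : unitInterval → X) (x := h) ⟨self_mem_Iic, fun _ hb => hb⟩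
    ⟨self_mem_Ici, fun _ hb => hb⟩]
  let φ : unitInterval → unitInterval := fun t => projIcc 0 1 zero_le_one (2 * (t : ℝ))
  let ψ : unitInterval → unitInterval := fun t => projIcc 0 1 zero_le_one (2 * (t : ℝ) - 1)
  have hφ : Monotone φ := fun s t hst => monotone_projIcc _ (by
    have : (s : ℝ) ≤ t := hst
    linarith)
  have hψ : Monotone ψ := fun s t hst => monotone_projIcc _ (by
    have : (s : ℝ) ≤ t := hst
    linarith)
  have h1 : EqOn (γ.trans δ) (γ ∘ φ) (Iic h) := by
    intro t ht
    have ht' : (t : ℝ) ≤ 1 / 2 := ht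
    simp only [Path.trans_apply, ht', Function.comp, dif_pos]
    congr 1
    exact (projIcc_of_mem zero_le_one _).symm
  have h2 : EqOn (γ.trans δ) (δ ∘ ψ) (Ici h) := by
    intro t ht
    have ht' : 1 / 2 ≤ (t : ℝ) := ht
    rcases eq_or_lt_of_le ht' with h0 | h0
    · have h3 : ψ t = 0 := by
        simp only [ψ, ← h0]
        norm_num
      simp [Path.trans_apply, ← h0, h3]
    · have h3 : ¬ (t : ℝ) ≤ 1 / 2 := not_le.2 h0
      simp only [Path.trans_apply, h3, Function.comp, dif_neg, not_false_eq_true]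
      congr 1
      exact (projIcc_of_mem zero_le_one _).symm
  rw [eVariationOn.congr h1, eVariationOn.congr h2]
  exact add_le_add
    (eVariationOn.comp_le_of_monotoneOn _ φ (hφ.monotoneOn _) (mapsTo_univ _ _))
    (eVariationOn.comp_le_of_monotoneOn _ ψ (hψ.monotoneOn _) (mapsTo_univ _ _))

theorem inducedLengthEDist_triangle {X : Type*} [MetricSpace X] (x y z : X) :
    inducedLengthEDist x z ≤ inducedLengthEDist x y + inducedLengthEDist y z := by
  unfold inducedLengthEDist
  exact ENNReal.le_iInf_add_iInf fun γ δ =>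
    (iInf_le _ (γ.trans δ)).trans (curveLength_trans_le γ δ)

/-- The induced length metric as a metric with values in `[0,∞]`. -/
@[reducible]
def inducedLengthEMetric (X : Type*) [MetricSpace X] : EMetricSpace X where
  edist := inducedLengthEDist
  edist_self := inducedLengthEDist_self
  edist_comm x y := le_antisymm (inducedLengthEDist_comm_le x y) (inducedLengthEDist_comm_le y x)
  edist_triangle := inducedLengthEDist_triangle
  eq_of_edist_eq_zero {x y} hxy :=
    edist_le_zero.1 ((edist_le_inducedLengthEDist x y).trans (le_of_eq hxy))

/-- The induced length metric on `X`, once any two points of `X` are joined by a rectifiable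
curve. -/
@[reducible]
def inducedLengthMetric (X : Type*) [MetricSpace X]
    (h : ∀ x y : X, inducedLengthEDist x y ≠ ⊤) : MetricSpace X :=
  @EMetricSpace.toMetricSpace X (inducedLengthEMetric X) h

theorem inducedLengthMetric_dist {X : Type*} [MetricSpace X]
    (h : ∀ x y : X, inducedLengthEDist x y ≠ ⊤) (x y : X) :
    @dist X (inducedLengthMetric X h).toDist x y = (inducedLengthEDist x y).toReal :=
  rfl

/-! ### Geodesics and geodesic bicombings -/

/-- A geodesic, parametrized on `[0,1]` with constant speed. -/
def IsGeodesic {X : Type*} [MetricSpace X] (c : unitInterval → X) : Prop :=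
  Continuous c ∧ ∀ s t : unitInterval, dist (c s) (c t) = |(s : ℝ) - t| * dist (c 0) (c 1)

/-- The function `t ↦ d(c(t), c'(t))` is convex on `[0,1]`. -/
def HasConvexDist {X : Type*} [MetricSpace X] (c c' : unitInterval → X) : Prop :=
  ConvexOn ℝ (Icc (0 : ℝ) 1) (IccExtend zero_le_one fun t : unitInterval => dist (c t) (c' t))

/-- `τ` is a geodesic bicombing on the metric space `X`: a selection of a geodesic `τ x y` from
`x` to `y` for all `x, y`, which is consistent with taking subsegments. -/
structure IsGeodesicBicombing {X : Type*} [MetricSpace X] (τ : X → X → unitInterval → X) : Prop where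
  isGeodesic : ∀ x y, IsGeodesic (τ x y)
  source : ∀ x y, τ x y 0 = x
  target : ∀ x y, τ x y 1 = y
  consistent : ∀ x y p q, p ∈ range (τ x y) → q ∈ range (τ x y) → dist x p ≤ dist x q →
    range (τ p q) ⊆ range (τ x y)

/-- A convex geodesic bicombing. -/
structure IsConvexGeodesicBicombing {X : Type*} [MetricSpace X] (τ : X → X → unitInterval → X) : Prop
    extends IsGeodesicBicombing τ where
  convex : ∀ x y x' y', HasConvexDist (τ x y) (τ x' y')

/-- A geodesic bicombing is reversible if the segments from `x` to `y` and from `y` to `x`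
have the same image. -/
def IsReversibleBicombing {X : Type*} (τ : X → X → unitInterval → X) : Prop :=
  ∀ x y, range (τ y x) = range (τ x y)

/-! ### Local geodesic bicombings -/

/-- The pairs of points that lie in a common open ball `U(x, r x)`. -/
def localDomain {X : Type*} [MetricSpace X] (r : X → ℝ) : Set (X × X) :=
  {p | ∃ x, p.1 ∈ ball x (r x) ∧ p.2 ∈ ball x (r x)}

/-- A local geodesic bicombing on `X`: for every `x` a radius `r x > 0`, and a selection
`(y, z) ↦ seg y z` of geodesics from `y` to `z` for the pairs `(y, z)` that lie in a common ball
`U(x, r x)`, such that the geodesic stays in that ball, and subsegments of selected geodesics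
are selected. The values of `seg` at other pairs are irrelevant. -/
structure LocalGeodesicBicombing (X : Type*) [MetricSpace X] where
  r : X → ℝ
  r_pos : ∀ x, 0 < r x
  seg : X → X → unitInterval → X
  isGeodesic : ∀ y z, (y, z) ∈ localDomain r → IsGeodesic (seg y z)
  source : ∀ y z, (y, z) ∈ localDomain r → seg y z 0 = y
  target : ∀ y z, (y, z) ∈ localDomain r → seg y z 1 = z
  mem_ball : ∀ x, ∀ y ∈ ball x (r x), ∀ z ∈ ball x (r x), ∀ t, seg y z t ∈ ball x (r x)
  /-- Here `Icc.convexComb a b t` is the number `(1 - t) * a + t * b`. -/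
  consistent : ∀ y z, (y, z) ∈ localDomain r → ∀ a b : unitInterval, a ≤ b → ∀ t : unitInterval,
    seg (seg y z a) (seg y z b) t = seg y z (Icc.convexComb a b t)

namespace LocalGeodesicBicombing

/-- Convexity of a local geodesic bicombing, on each of the balls `U(x, r x)`. -/
def IsConvex {X : Type*} [MetricSpace X] (σ : LocalGeodesicBicombing X) : Prop :=
  ∀ x, ∀ y ∈ ball x (σ.r x), ∀ z ∈ ball x (σ.r x), ∀ y' ∈ ball x (σ.r x),
    ∀ z' ∈ ball x (σ.r x), HasConvexDist (σ.seg y z) (σ.seg y' z')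

/-- Reversibility of a local geodesic bicombing. -/
def IsReversible {X : Type*} [MetricSpace X] (σ : LocalGeodesicBicombing X) : Prop :=
  ∀ y z, (y, z) ∈ localDomain σ.r → ∀ t : unitInterval, σ.seg z y t = σ.seg y z (unitInterval.symm t)

/-- The curve `c` is consistent with the local geodesic bicombing `σ`. -/
def IsConsistent {X : Type*} [MetricSpace X] (σ : LocalGeodesicBicombing X) (c : unitInterval → X) : Prop :=
  ∀ a b : unitInterval, a ≤ b → (c a, c b) ∈ localDomain σ.r → ∀ t : unitInterval,
    c (Icc.convexComb a b t) = σ.seg (c a) (c b) t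

end LocalGeodesicBicombing

end

/-!
The argument follows the Cartan–Hadamard theorem of Alexander and Bishop. Call a curve locally
consistent if all its short pieces are geodesics of `σ`. The distance between two such curves that
stay close to each other is convex. Two overlapping deformations of pieces of a locally consistent
curve can be fitted together by Banach's fixed point theorem, so every locally consistent curve
deforms uniquely with its endpoints. Hence, on the complete space of locally consistent curves from
`x`, the endpoint map is a local isometry. It therefore lifts paths, and as `X` is simply connected,
it is bijective. So any two points are joined by a unique locally consistent curve, whose speed is
their induced length distance because that speed is locally 1-Lipschitz in the endpoint.
-/

open Filter Topology

theorem rel_of_eventually_rel_Icc {α : Type*} [ConditionallyCompleteLinearOrder α]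
    [TopologicalSpace α] [OrderTopology α] [DenselyOrdered α] {a b : α} (hab : a ≤ b)
    {P : α → α → Prop} (trans : ∀ s t, a ≤ s → s ≤ t → t ≤ b → P a s → P s t → P a t)
    (loc : ∀ t ∈ Icc a b, ∀ᶠ s in 𝓝[Icc a b] t, (s ≤ t → P s t) ∧ (t ≤ s → P t s)) :
    P a b := by
  let S : Set α := {t ∈ Icc a b | P a t}
  have haS : a ∈ S := by
    have ha : a ∈ Icc a b := left_mem_Icc.2 hab
    exact ⟨ha, ((loc a ha).self_of_nhdsWithin ha).1 le_rfl⟩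
  have hlub : IsLUB S (sSup S) := isLUB_csSup ⟨a, haS⟩ ⟨b, fun t ht => ht.1.2⟩
  set m := sSup S
  have hm : m ∈ Icc a b := ⟨hlub.1 haS, hlub.2 fun t ht => ht.1.2⟩
  have hPm : P a m := by
    have hnear : ∃ᶠ s in 𝓝[Icc a b] m, s ∈ S := frequently_nhdsWithin_iff.2 <|
      (mem_closure_iff_frequently.1 (hlub.mem_closure ⟨a, haS⟩)).mono fun s hs => ⟨hs, hs.1⟩
    obtain ⟨s, hs, hsm⟩ := (hnear.and_eventually (loc m hm)).exists
    exact trans s m hs.1.1 (hlub.1 hs) hm.2 hs.2 (hsm.1 (hlub.1 hs))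
  refine hm.2.eq_or_lt.elim (fun h => h ▸ hPm) fun hmb => ?_
  have hright : 𝓝[Ioc m b] m ≤ 𝓝[Icc a b] m :=
    nhdsWithin_mono m fun s hs => ⟨hm.1.trans hs.1.le, hs.2⟩
  have : (𝓝[Ioc m b] m).NeBot := by
    rw [nhdsWithin_Ioc_eq_nhdsGT hmb]
    exact nhdsGT_neBot_of_exists_gt ⟨b, hmb⟩
  obtain ⟨s, hs, hms⟩ := (((loc m hm).filter_mono hright).and self_mem_nhdsWithin).exists
  have hsS : s ∈ S :=
    ⟨⟨hm.1.trans hms.1.le, hms.2⟩, trans m s hm.1 hms.1.le hms.2 hPm (hs.2 hms.1.le)⟩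
  exact absurd (hlub.1 hsS) hms.1.not_ge

theorem Icc_zero_one : Icc (0 : unitInterval) 1 = univ :=
  Icc_bot_top

section ConvexComb

variable {α β : ℝ} {a b : Icc α β}

theorem exists_convexComb_eq {t : Icc α β} (ht : t ∈ Icc a b) : ∃ s, Icc.convexComb a b s = t :=
  ⟨_, (Icc.eq_convexComb ht.1 ht.2).symm⟩

theorem convexComb_convexComb (a b : Icc α β) (u v s : unitInterval) :
    Icc.convexComb (Icc.convexComb a b u) (Icc.convexComb a b v) s =
      Icc.convexComb a b (Icc.convexComb u v s) := by
  ext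
  simp only [Icc.coe_convexComb]
  ring

theorem convexComb_mono (hab : a ≤ b) : Monotone (Icc.convexComb a b) := by
  intro u v huv
  have h : (u : ℝ) * (b - a) ≤ v * (b - a) := by gcongr; exact sub_nonneg.2 hab
  rw [← Subtype.coe_le_coe, Icc.coe_convexComb, Icc.coe_convexComb]
  linarith

theorem convexComb_mem_Icc (hab : a ≤ b) (s : unitInterval) : Icc.convexComb a b s ∈ Icc a b :=
  ⟨Icc.le_convexComb hab s, Icc.convexComb_le hab s⟩

theorem dist_convexComb (a b : Icc α β) (s t : unitInterval) :
    dist (Icc.convexComb a b s) (Icc.convexComb a b t) = dist a b * dist s t := by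
  simp only [Subtype.dist_eq, Real.dist_eq, Icc.coe_convexComb, ← abs_mul]
  rw [← abs_neg]
  ring_nf

theorem convexComb_injective (hab : a ≠ b) : Function.Injective (Icc.convexComb a b) :=
  fun s t h => by
    have hdist := dist_convexComb a b s t
    rw [h, dist_self, eq_comm, mul_eq_zero] at hdist
    exact dist_eq_zero.1 (hdist.resolve_left (dist_ne_zero.2 hab))

theorem exists_continuous_convexComb_rightInvOn (hab : a < b) :
    ∃ τ : Icc α β → unitInterval, Continuous τ ∧ RightInvOn τ (Icc.convexComb a b) (Icc a b) := by
  refine ⟨fun t => projIcc 0 1 zero_le_one ((t - a) / (b - a)), by fun_prop, fun t ht => ?_⟩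
  have hpos : (0 : ℝ) < b - a := sub_pos.2 hab
  have hmem : ((t : ℝ) - a) / (b - a) ∈ Icc (0 : ℝ) 1 :=
    ⟨div_nonneg (sub_nonneg.2 ht.1) hpos.le,
      div_le_one_of_le₀ (sub_le_sub_right (a := (t : ℝ)) ht.2 _) hpos.le⟩
  beta_reduce
  rw [projIcc_of_mem zero_le_one hmem]
  exact (Icc.eq_convexComb ht.1 ht.2).symm

end ConvexComb

/-- A real function on `[0, 1]` satisfying the inequality of convexity on a neighbourhood of every
point. -/
def IsLocallyConvex (f : unitInterval → ℝ) : Prop :=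
  ∀ t, ∀ᶠ p : unitInterval × unitInterval in 𝓝 (t, t), p.1 ≤ p.2 → ∀ s : unitInterval,
    f (Icc.convexComb p.1 p.2 s) ≤ (1 - s) * f p.1 + s * f p.2

namespace IsLocallyConvex

variable {f : unitInterval → ℝ}

theorem nonpos (loc : IsLocallyConvex f) (hf : Continuous f) (h₀ : f 0 ≤ 0) (h₁ : f 1 ≤ 0)
    (t : unitInterval) : f t ≤ 0 := by
  obtain ⟨M, -, hM⟩ := isCompact_univ.exists_isMaxOn univ_nonempty hf.continuousOn
  replace hM : ∀ u, f u ≤ f M := fun u => hM (mem_univ u)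
  refine (hM t).trans (not_lt.1 fun hpos => ?_)
  -- At the leftmost maximum the inequality of convexity would have to be strict.
  obtain ⟨m, hm, hleast⟩ :=
    (isClosed_eq hf continuous_const : IsClosed {u | f u = f M}).isCompact.exists_isLeast ⟨M, rfl⟩
  have hm₀ : 0 < m := bot_lt_iff_ne_bot.2 fun h => by
    rw [← hm, h] at hpos
    exact hpos.not_ge h₀
  have hm₁ : m < 1 := lt_top_iff_ne_top.2 fun h => by
    rw [← hm, h] at hpos
    exact hpos.not_ge h₁
  have : (𝓝[<] m).NeBot := nhdsLT_neBot_of_exists_lt ⟨0, hm₀⟩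
  have : (𝓝[>] m).NeBot := nhdsGT_neBot_of_exists_gt ⟨1, hm₁⟩
  have hle : 𝓝[<] m ×ˢ 𝓝[>] m ≤ 𝓝 (m, m) := by
    rw [nhds_prod_eq]
    exact prod_mono nhdsWithin_le_nhds nhdsWithin_le_nhds
  obtain ⟨⟨a, b⟩, hconv, ha : a < m, hb : m < b⟩ := (((loc m).filter_mono hle).and
    (prod_mem_prod self_mem_nhdsWithin self_mem_nhdsWithin)).exists
  obtain ⟨s, hs⟩ := exists_convexComb_eq (t := m) ⟨ha.le, hb.le⟩
  have hs₁ : (s : ℝ) < 1 := unitInterval.lt_one_iff_ne_one.2 fun h => by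
    rw [h, Icc.convexComb_one] at hs
    exact hb.ne' hs
  have hfa : f a < f M := (hM a).lt_of_ne fun h => (hleast h).not_gt ha
  have hconv := hconv (ha.trans hb).le s
  rw [hs, hm] at hconv
  nlinarith [mul_pos (sub_pos.2 hs₁) (sub_pos.2 hfa), mul_nonneg s.2.1 (sub_nonneg.2 (hM b))]

theorem le_chord (loc : IsLocallyConvex f) (hf : Continuous f) (t : unitInterval) :
    f t ≤ (1 - t) * f 0 + t * f 1 := by
  let g : unitInterval → ℝ := fun t => f t - ((1 - t) * f 0 + t * f 1)
  have hg : IsLocallyConvex g := fun t => (loc t).mono fun p hp hle s => by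
    have := hp hle s
    simp only [g, Icc.coe_convexComb]
    linarith
  have := hg.nonpos (by fun_prop) (by simp [g]) (by simp [g]) t
  exact sub_nonpos.1 this

end IsLocallyConvex

/-! ### Locally consistent curves -/

namespace LocalGeodesicBicombing

variable {X : Type*} [MetricSpace X] {σ : LocalGeodesicBicombing X}

theorem mem_localDomain {x y z : X} (hy : y ∈ ball x (σ.r x)) (hz : z ∈ ball x (σ.r x)) :
    (y, z) ∈ localDomain σ.r :=
  ⟨x, hy, hz⟩

theorem mem_ball_self (σ : LocalGeodesicBicombing X) (x : X) : x ∈ ball x (σ.r x) :=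
  Metric.mem_ball_self (σ.r_pos x)

theorem mem_localDomain_self (σ : LocalGeodesicBicombing X) (x : X) :
    (x, x) ∈ localDomain σ.r :=
  mem_localDomain (σ.mem_ball_self x) (σ.mem_ball_self x)

theorem seg_self (σ : LocalGeodesicBicombing X) (x : X) (t : unitInterval) : σ.seg x x t = x := by
  have hx := σ.mem_localDomain_self x
  have h := (σ.isGeodesic x x hx).2 t 0
  rw [σ.source x x hx, σ.target x x hx, dist_self, mul_zero] at h
  exact dist_eq_zero.1 h

theorem IsConvex.dist_seg_le (hσ : σ.IsConvex) {x y z y' z' : X} (hy : y ∈ ball x (σ.r x))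
    (hz : z ∈ ball x (σ.r x)) (hy' : y' ∈ ball x (σ.r x)) (hz' : z' ∈ ball x (σ.r x))
    (t : unitInterval) :
    dist (σ.seg y z t) (σ.seg y' z' t) ≤ (1 - t) * dist y y' + t * dist z z' := by
  obtain ⟨-, h⟩ := hσ x y hy z hz y' hy' z' hz'
  replace h := h (left_mem_Icc.2 zero_le_one) (right_mem_Icc.2 zero_le_one) (a := 1 - t) (b := t)
    (sub_nonneg.2 t.2.2) t.2.1 (sub_add_cancel _ _)
  have e : (1 - (t : ℝ)) • (0 : ℝ) + (t : ℝ) • 1 = t := by simp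
  rw [e, IccExtend_val, IccExtend_left, IccExtend_right] at h
  change _ ≤ (1 - (t : ℝ)) * dist (σ.seg y z 0) (σ.seg y' z' 0)
    + t * dist (σ.seg y z 1) (σ.seg y' z' 1) at h
  have d := mem_localDomain hy hz
  have d' := mem_localDomain hy' hz'
  rwa [σ.source y z d, σ.target y z d, σ.source _ _ d', σ.target _ _ d'] at h

theorem IsConvex.tendsto_seg (hσ : σ.IsConvex) {ι : Type*} {l : Filter ι} {f g : ι → X} {y z x : X}
    (hf : Tendsto f l (𝓝 y)) (hg : Tendsto g l (𝓝 z)) (hy : y ∈ ball x (σ.r x))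
    (hz : z ∈ ball x (σ.r x)) (t : unitInterval) :
    Tendsto (fun i => σ.seg (f i) (g i) t) l (𝓝 (σ.seg y z t)) := by
  have hlim : Tendsto (fun i => (1 - (t : ℝ)) * dist (f i) y + t * dist (g i) z) l (𝓝 0) := by
    simpa only [mul_zero, add_zero] using
      ((tendsto_iff_dist_tendsto_zero.1 hf).const_mul (1 - (t : ℝ))).add
        ((tendsto_iff_dist_tendsto_zero.1 hg).const_mul (t : ℝ))
  refine tendsto_iff_dist_tendsto_zero.2 (squeeze_zero' (.of_forall fun _ => dist_nonneg) ?_ hlim)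
  filter_upwards [hf.eventually (isOpen_ball.mem_nhds hy), hg.eventually (isOpen_ball.mem_nhds hz)]
    with i hfi hgi
  exact hσ.dist_seg_le hfi hgi hy hz t

/-- The curve `c` is continuous on `S`, and near every point of `S` its pieces within `S` are
geodesics of `σ`. -/
def IsLocallyConsistentOn (σ : LocalGeodesicBicombing X) (c : unitInterval → X)
    (S : Set unitInterval) : Prop :=
  ContinuousOn c S ∧ ∀ t ∈ S, ∀ᶠ p in 𝓝[S] t ×ˢ 𝓝[S] t, p.1 ≤ p.2 →
    ∀ s, c (Icc.convexComb p.1 p.2 s) = σ.seg (c p.1) (c p.2) s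

/-- The curve `c` is continuous and all its short pieces are geodesics of `σ`. -/
def IsLocallyConsistent (σ : LocalGeodesicBicombing X) (c : unitInterval → X) : Prop :=
  Continuous c ∧ ∀ t, ∀ᶠ p : unitInterval × unitInterval in 𝓝 (t, t), p.1 ≤ p.2 →
    ∀ s : unitInterval, c (Icc.convexComb p.1 p.2 s) = σ.seg (c p.1) (c p.2) s

theorem isLocallyConsistentOn_univ {c : unitInterval → X} :
    σ.IsLocallyConsistentOn c univ ↔ σ.IsLocallyConsistent c := by
  simp only [IsLocallyConsistentOn, IsLocallyConsistent, continuousOn_univ, mem_univ, true_imp_iff,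
    nhdsWithin_univ, nhds_prod_eq]

theorem isLocallyConsistent_seg {y z : X} (h : (y, z) ∈ localDomain σ.r) :
    σ.IsLocallyConsistent (σ.seg y z) :=
  ⟨(σ.isGeodesic y z h).1, fun _ => .of_forall fun p hp s =>
    (σ.consistent y z h p.1 p.2 hp s).symm⟩

theorem isLocallyConsistent_const (σ : LocalGeodesicBicombing X) (x : X) :
    σ.IsLocallyConsistent fun _ => x :=
  ⟨continuous_const, fun _ => .of_forall fun _ _ s => (σ.seg_self x s).symm⟩

namespace IsLocallyConsistentOn

variable {c c' : unitInterval → X} {S T : Set unitInterval} {a b u v : unitInterval}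

theorem mono (hc : σ.IsLocallyConsistentOn c T) (h : S ⊆ T) : σ.IsLocallyConsistentOn c S :=
  ⟨hc.1.mono h, fun t ht =>
    (hc.2 t (h ht)).filter_mono (prod_mono (nhdsWithin_mono t h) (nhdsWithin_mono t h))⟩

theorem congr_Icc (hc : σ.IsLocallyConsistentOn c (Icc a b)) (h : EqOn c' c (Icc a b)) :
    σ.IsLocallyConsistentOn c' (Icc a b) := by
  refine ⟨hc.1.congr h, fun t ht => ?_⟩
  filter_upwards [hc.2 t ht, prod_mem_prod self_mem_nhdsWithin self_mem_nhdsWithin]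
    with p hp hpS hle s
  rw [h hpS.1, h hpS.2, ← hp hle s]
  exact h (Icc_subset_Icc hpS.1.1 hpS.2.2 (convexComb_mem_Icc hle s))

theorem union_Icc (h₁ : σ.IsLocallyConsistentOn c (Icc a v))
    (h₂ : σ.IsLocallyConsistentOn c (Icc u b)) (huv : u < v) :
    σ.IsLocallyConsistentOn c (Icc a b) := by
  have hloc : ∀ t ∈ Icc a b, (t ∈ Icc a v ∧ 𝓝[Icc a b] t ≤ 𝓝[Icc a v] t) ∨
      (t ∈ Icc u b ∧ 𝓝[Icc a b] t ≤ 𝓝[Icc u b] t) := fun t ht => by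
    rcases lt_or_ge t v with htv | hvt
    · refine .inl ⟨⟨ht.1, htv.le⟩, nhdsWithin_le_iff.2 ?_⟩
      filter_upwards [self_mem_nhdsWithin, mem_nhdsWithin_of_mem_nhds (Iio_mem_nhds htv)]
        with s hs hsv using ⟨hs.1, le_of_lt hsv⟩
    · have hut := huv.trans_le hvt
      refine .inr ⟨⟨hut.le, ht.2⟩, nhdsWithin_le_iff.2 ?_⟩
      filter_upwards [self_mem_nhdsWithin, mem_nhdsWithin_of_mem_nhds (Ioi_mem_nhds hut)]
        with s hs hus using ⟨le_of_lt hus, hs.2⟩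
  refine ⟨fun t ht => ?_, fun t ht => ?_⟩ <;> rcases hloc t ht with ⟨htS, hle⟩ | ⟨htS, hle⟩
  · exact (h₁.1 t htS).mono_left hle
  · exact (h₂.1 t htS).mono_left hle
  · exact (h₁.2 t htS).filter_mono (prod_mono hle hle)
  · exact (h₂.2 t htS).filter_mono (prod_mono hle hle)

theorem comp_convexComb (hc : σ.IsLocallyConsistentOn c (Icc a b)) (hab : a ≤ b) :
    σ.IsLocallyConsistent fun t => c (Icc.convexComb a b t) := by
  have hcont : Continuous (Icc.convexComb a b) := by fun_prop
  refine ⟨hc.1.comp_continuous hcont (convexComb_mem_Icc hab), fun t => ?_⟩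
  have h : Tendsto (Icc.convexComb a b) (𝓝 t) (𝓝[Icc a b] (Icc.convexComb a b t)) :=
    tendsto_nhdsWithin_iff.2 ⟨hcont.tendsto t, .of_forall (convexComb_mem_Icc hab)⟩
  rw [nhds_prod_eq]
  filter_upwards [(h.prodMap h).eventually (hc.2 _ (convexComb_mem_Icc hab t))] with p hp hle s
  rw [← convexComb_convexComb]
  exact hp (convexComb_mono hab hle) s

end IsLocallyConsistentOn

namespace IsLocallyConsistent

variable {c c' : unitInterval → X} {a b : unitInterval}

theorem isLocallyConsistentOn (hc : σ.IsLocallyConsistent c) (S : Set unitInterval) :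
    σ.IsLocallyConsistentOn c S :=
  (isLocallyConsistentOn_univ.2 hc).mono (subset_univ S)

theorem comp_convexComb (hc : σ.IsLocallyConsistent c) (hab : a ≤ b) :
    σ.IsLocallyConsistent fun t => c (Icc.convexComb a b t) :=
  (hc.isLocallyConsistentOn (Icc a b)).comp_convexComb hab

theorem comp_rightInvOn (hc : σ.IsLocallyConsistent c) (hab : a < b)
    {τ : unitInterval → unitInterval} (hτ : Continuous τ)
    (hinv : RightInvOn τ (Icc.convexComb a b) (Icc a b)) :
    σ.IsLocallyConsistentOn (c ∘ τ) (Icc a b) := by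
  refine ⟨(hc.1.comp hτ).continuousOn, fun t _ => ?_⟩
  have h : Tendsto τ (𝓝[Icc a b] t) (𝓝 (τ t)) := hτ.continuousWithinAt
  have hloc := hc.2 (τ t)
  rw [nhds_prod_eq] at hloc
  filter_upwards [(h.prodMap h).eventually hloc,
    prod_mem_prod self_mem_nhdsWithin self_mem_nhdsWithin] with p hp ⟨hp₁, hp₂⟩ hle s
  have hinj := convexComb_injective hab.ne
  have hτle : τ p.1 ≤ τ p.2 := by
    rw [← ((convexComb_mono hab.le).strictMono_of_injective hinj).le_iff_le, hinv hp₁, hinv hp₂]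
    exact hle
  have hτs : τ (Icc.convexComb p.1 p.2 s) = Icc.convexComb (τ p.1) (τ p.2) s := by
    apply hinj
    rw [hinv (Icc_subset_Icc hp₁.1 hp₂.2 (convexComb_mem_Icc hle s)), ← convexComb_convexComb,
      hinv hp₁, hinv hp₂]
  simp only [Function.comp_apply, hτs]
  exact hp hτle s

theorem symm (hr : σ.IsReversible) (hc : σ.IsLocallyConsistent c) :
    σ.IsLocallyConsistent fun t => c (unitInterval.symm t) := by
  have hcont : Continuous fun t => c (unitInterval.symm t) :=
    hc.1.comp unitInterval.continuous_symm
  refine ⟨hcont, fun t => ?_⟩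
  have h : Tendsto (fun p : unitInterval × unitInterval =>
      (unitInterval.symm p.2, unitInterval.symm p.1)) (𝓝 (t, t))
      (𝓝 (unitInterval.symm t, unitInterval.symm t)) :=
    Continuous.tendsto' (by fun_prop) _ _ rfl
  have hb := hcont.continuousAt.eventually
    (isOpen_ball.mem_nhds (σ.mem_ball_self (c (unitInterval.symm t))))
  filter_upwards [h.eventually (hc.2 _), hb.prod_nhds hb] with p hp hpb hle s
  have hcomb : unitInterval.symm (Icc.convexComb p.1 p.2 s) =
      Icc.convexComb (unitInterval.symm p.2) (unitInterval.symm p.1) (unitInterval.symm s) := by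
    ext
    simp only [unitInterval.coe_symm_eq, Icc.coe_convexComb]
    ring
  rw [hr _ _ (mem_localDomain hpb.2 hpb.1), hcomb]
  exact hp (unitInterval.symm_le_symm.2 hle) (unitInterval.symm s)

theorem dist_le (hσ : σ.IsConvex) (hc : σ.IsLocallyConsistent c) (hc' : σ.IsLocallyConsistent c')
    (h : ∀ t, ∃ x, c t ∈ ball x (σ.r x) ∧ c' t ∈ ball x (σ.r x)) (t : unitInterval) :
    dist (c t) (c' t) ≤ (1 - t) * dist (c 0) (c' 0) + t * dist (c 1) (c' 1) := by
  have hloc : IsLocallyConvex fun t => dist (c t) (c' t) := fun t => by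
    obtain ⟨x, hx, hx'⟩ := h t
    have hb := (hc.1.continuousAt.eventually (isOpen_ball.mem_nhds hx)).and
      (hc'.1.continuousAt.eventually (isOpen_ball.mem_nhds hx'))
    filter_upwards [hc.2 t, hc'.2 t, hb.prod_nhds hb] with p hp hp' hpb hle s
    rw [hp hle, hp' hle]
    exact hσ.dist_seg_le hpb.1.1 hpb.2.1 hpb.1.2 hpb.2.2 s
  exact hloc.le_chord (hc.1.dist hc'.1) t

theorem eq_seg (hσ : σ.IsConvex) (hc : σ.IsLocallyConsistent c) {x : X}
    (h : ∀ t, c t ∈ ball x (σ.r x)) (t : unitInterval) : c t = σ.seg (c 0) (c 1) t := by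
  have d := mem_localDomain (h 0) (h 1)
  have hdist := hc.dist_le hσ (isLocallyConsistent_seg d)
    (fun t => ⟨x, h t, σ.mem_ball x _ (h 0) _ (h 1) t⟩) t
  rw [σ.source _ _ d, σ.target _ _ d, dist_self, dist_self, mul_zero, mul_zero, add_zero] at hdist
  exact dist_le_zero.1 hdist

end IsLocallyConsistent

theorem IsLocallyConsistentOn.dist_convexComb_le (hσ : σ.IsConvex) {c c' : unitInterval → X}
    {a b : unitInterval} (hc : σ.IsLocallyConsistentOn c (Icc a b))
    (hc' : σ.IsLocallyConsistentOn c' (Icc a b)) (hab : a ≤ b)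
    (h : ∀ t ∈ Icc a b, ∃ x, c t ∈ ball x (σ.r x) ∧ c' t ∈ ball x (σ.r x)) (s : unitInterval) :
    dist (c (Icc.convexComb a b s)) (c' (Icc.convexComb a b s)) ≤
      (1 - s) * dist (c a) (c' a) + s * dist (c b) (c' b) := by
  simpa only [Icc.convexComb_zero, Icc.convexComb_one] using
    (hc.comp_convexComb hab).dist_le hσ (hc'.comp_convexComb hab)
      (fun u => h _ (convexComb_mem_Icc hab u)) s

theorem IsLocallyConsistentOn.dist_le_of_endpoints (hσ : σ.IsConvex) {c c' : unitInterval → X}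
    {a b t : unitInterval} {ε : ℝ} (hc : σ.IsLocallyConsistentOn c (Icc a b))
    (hc' : σ.IsLocallyConsistentOn c' (Icc a b))
    (h : ∀ t ∈ Icc a b, ∃ x, c t ∈ ball x (σ.r x) ∧ c' t ∈ ball x (σ.r x))
    (ha : dist (c a) (c' a) ≤ ε) (hb : dist (c b) (c' b) ≤ ε) (ht : t ∈ Icc a b) :
    dist (c t) (c' t) ≤ ε := by
  obtain ⟨s, rfl⟩ := exists_convexComb_eq ht
  refine (hc.dist_convexComb_le hσ hc' (ht.1.trans ht.2) h s).trans ?_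
  have := mul_le_mul_of_nonneg_left ha (sub_nonneg.2 s.2.2)
  have := mul_le_mul_of_nonneg_left hb s.2.1
  linarith

theorem IsConvex.isClosed_isLocallyConsistent (hσ : σ.IsConvex) :
    IsClosed {c : C(unitInterval, X) | σ.IsLocallyConsistent c} := by
  refine IsSeqClosed.isClosed fun f c hf hfc => ⟨c.continuous, fun t => ?_⟩
  set x := c t
  have hr : 0 < σ.r x / 2 := half_pos (σ.r_pos x)
  obtain ⟨a, b, -, hnhds, hball⟩ := exists_Icc_mem_subset_of_mem_nhds
    (c.continuous.continuousAt.eventually (ball_mem_nhds x hr))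
  have hsub : ball x (σ.r x / 2) ⊆ ball x (σ.r x) := ball_subset_ball (half_le_self (σ.r_pos x).le)
  filter_upwards [prod_mem_nhds hnhds hnhds] with p hp hle s
  have hfseg : ∀ᶠ n in atTop, σ.seg (f n p.1) (f n p.2) s = f n (Icc.convexComb p.1 p.2 s) := by
    filter_upwards [hfc.eventually (ball_mem_nhds c hr)] with n hn
    have hin : ∀ u, f n (Icc.convexComb p.1 p.2 u) ∈ ball x (σ.r x) := fun u => by
      have hfar := (ContinuousMap.dist_apply_le_dist (Icc.convexComb p.1 p.2 u)).trans_lt hn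
      have hnear := hball (Icc_subset_Icc hp.1.1 hp.2.2 (convexComb_mem_Icc hle u))
      exact (dist_triangle _ _ _).trans_lt ((add_lt_add hfar hnear).trans_eq (add_halves _))
    simpa only [Icc.convexComb_zero, Icc.convexComb_one, eq_comm] using
      ((hf n).comp_convexComb hle).eq_seg hσ hin s
  have hlim : ∀ u, Tendsto (fun n => f n u) atTop (𝓝 (c u)) := fun u =>
    ((continuous_eval_const u).tendsto c).comp hfc
  exact tendsto_nhds_unique (hlim _) ((hσ.tendsto_seg (hlim p.1) (hlim p.2) (hsub (hball hp.1))
    (hsub (hball hp.2)) s).congr' hfseg)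

end LocalGeodesicBicombing

/-! ### Deformations of locally consistent curves -/

namespace LocalGeodesicBicombing

variable {X : Type*} [MetricSpace X] {σ : LocalGeodesicBicombing X} {c c₁ c₂ : unitInterval → X}
  {a b u v : unitInterval} {ε : ℝ}

/-- Any two points at distance at most `ε` from the same point of the curve `c` lie in a common
ball `U(x, r x)`. -/
def HasTube (σ : LocalGeodesicBicombing X) (c : unitInterval → X) (ε : ℝ) : Prop :=
  ∀ t, ∀ y ∈ closedBall (c t) ε, ∀ z ∈ closedBall (c t) ε,
    ∃ x, y ∈ ball x (σ.r x) ∧ z ∈ ball x (σ.r x)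

/-- A locally consistent curve over `[a, b]` in the tube of radius `ε` around the curve `c`. -/
structure IsDeformationOn (σ : LocalGeodesicBicombing X) (c : unitInterval → X) (ε : ℝ)
    (a b : unitInterval) (c' : unitInterval → X) : Prop where
  isLocallyConsistentOn : σ.IsLocallyConsistentOn c' (Icc a b)
  mem_closedBall : ∀ t ∈ Icc a b, c' t ∈ closedBall (c t) ε

/-- The part of the curve `c` over `[a, b]` has deformations with arbitrary endpoints at distance at
most `ε` from `c a` and `c b`. -/
def IsDeformableOn (σ : LocalGeodesicBicombing X) (c : unitInterval → X) (ε : ℝ)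
    (a b : unitInterval) : Prop :=
  ∀ y ∈ closedBall (c a) ε, ∀ z ∈ closedBall (c b) ε,
    ∃ c', σ.IsDeformationOn c ε a b c' ∧ c' a = y ∧ c' b = z

theorem exists_hasTube (σ : LocalGeodesicBicombing X) (hc : Continuous c) :
    ∃ ε > 0, σ.HasTube c ε ∧ ∃ η > 0, ∀ a b : unitInterval, (b : ℝ) - a ≤ η →
      ∃ x, ∀ t ∈ Icc a b, closedBall (c t) ε ⊆ ball x (σ.r x) := by
  obtain ⟨ρ, hρ, hleb⟩ := lebesgue_number_lemma_of_metric (isCompact_range hc)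
    (c := fun x => ball x (σ.r x)) (fun _ => isOpen_ball)
    (fun x _ => mem_iUnion.2 ⟨x, σ.mem_ball_self x⟩)
  obtain ⟨η, hη, huc⟩ := Metric.uniformContinuous_iff.1
    (CompactSpace.uniformContinuous_of_continuous hc) (ρ / 2) (half_pos hρ)
  have hshort : ∀ a b : unitInterval, (b : ℝ) - a ≤ η / 2 →
      ∃ x, ∀ t ∈ Icc a b, closedBall (c t) (ρ / 2) ⊆ ball x (σ.r x) := fun a b hab => by
    obtain ⟨x, hx⟩ := hleb (c a) (mem_range_self a)
    refine ⟨x, fun t ht y hy => hx ?_⟩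
    have hta : dist t a < η := by
      have hat : (a : ℝ) ≤ t := ht.1
      have htb : (t : ℝ) ≤ b := ht.2
      rw [Subtype.dist_eq, Real.dist_eq, abs_of_nonneg (sub_nonneg.2 hat)]
      linarith
    exact (dist_triangle _ _ _).trans_lt
      ((add_lt_add_of_le_of_lt hy (huc hta)).trans_eq (add_halves ρ))
  refine ⟨ρ / 2, half_pos hρ, fun t y hy z hz => ?_, η / 2, half_pos hη, hshort⟩
  obtain ⟨x, hx⟩ := hshort t t ((sub_self _).trans_le (half_pos hη).le)
  exact ⟨x, hx t ⟨le_rfl, le_rfl⟩ hy, hx t ⟨le_rfl, le_rfl⟩ hz⟩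

theorem IsLocallyConsistentOn.isDeformableOn (hσ : σ.IsConvex)
    (hc : σ.IsLocallyConsistentOn c (Icc a b)) (hab : a < b) {x : X}
    (hx : ∀ t ∈ Icc a b, closedBall (c t) ε ⊆ ball x (σ.r x)) : σ.IsDeformableOn c ε a b := by
  intro y hy z hz
  have ha : a ∈ Icc a b := left_mem_Icc.2 hab.le
  have hb : b ∈ Icc a b := right_mem_Icc.2 hab.le
  have hyx := hx a ha hy
  have hzx := hx b hb hz
  have d := mem_localDomain hyx hzx
  obtain ⟨τ, hτ, hinv⟩ := exists_continuous_convexComb_rightInvOn hab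
  have hinj := convexComb_injective hab.ne
  have hτa : τ a = 0 := hinj (by rw [hinv ha, Icc.convexComb_zero])
  have hτb : τ b = 1 := hinj (by rw [hinv hb, Icc.convexComb_one])
  have h₀ : (σ.seg y z ∘ τ) a = y := by rw [Function.comp_apply, hτa, σ.source _ _ d]
  have h₁ : (σ.seg y z ∘ τ) b = z := by rw [Function.comp_apply, hτb, σ.target _ _ d]
  have hseg := (isLocallyConsistent_seg d).comp_rightInvOn hab hτ hinv
  refine ⟨σ.seg y z ∘ τ, ⟨hseg, fun t ht => ?_⟩, h₀, h₁⟩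
  refine hseg.dist_le_of_endpoints hσ hc (fun s hs => ?_) (h₀.symm ▸ hy) (h₁.symm ▸ hz) ht
  exact ⟨x, σ.mem_ball x y hyx z hzx _, hx s hs (mem_closedBall_self (dist_nonneg.trans hy))⟩

namespace IsDeformationOn

theorem exists_mem_ball (h₁ : σ.IsDeformationOn c ε a b c₁) (h₂ : σ.IsDeformationOn c ε a b c₂)
    (htube : σ.HasTube c ε) : ∀ t ∈ Icc a b, ∃ x, c₁ t ∈ ball x (σ.r x) ∧ c₂ t ∈ ball x (σ.r x) :=
  fun t ht => htube t _ (h₁.mem_closedBall t ht) _ (h₂.mem_closedBall t ht)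

theorem mono (h : σ.IsDeformationOn c ε a b c₁) (hau : a ≤ u) (hvb : v ≤ b) :
    σ.IsDeformationOn c ε u v c₁ :=
  have hsub := Icc_subset_Icc hau hvb
  ⟨h.1.mono hsub, fun t ht => h.2 t (hsub ht)⟩

theorem eqOn (hσ : σ.IsConvex) (htube : σ.HasTube c ε) (h₁ : σ.IsDeformationOn c ε a b c₁)
    (h₂ : σ.IsDeformationOn c ε a b c₂) (ha : c₁ a = c₂ a) (hb : c₁ b = c₂ b) :
    EqOn c₁ c₂ (Icc a b) := fun _ ht =>
  dist_le_zero.1 <| h₁.1.dist_le_of_endpoints hσ h₂.1 (h₁.exists_mem_ball h₂ htube)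
    (dist_le_zero.2 ha) (dist_le_zero.2 hb) ht

theorem dist_le_of_eq_right (hσ : σ.IsConvex) (htube : σ.HasTube c ε)
    (h₁ : σ.IsDeformationOn c ε a b c₁) (h₂ : σ.IsDeformationOn c ε a b c₂) (hb : c₁ b = c₂ b)
    {t : unitInterval} (ht : t ∈ Icc a b) : dist (c₁ t) (c₂ t) ≤ dist (c₁ a) (c₂ a) :=
  h₁.1.dist_le_of_endpoints hσ h₂.1 (h₁.exists_mem_ball h₂ htube) le_rfl
    ((dist_le_zero.2 hb).trans dist_nonneg) ht

theorem dist_convexComb_le_of_eq_left (hσ : σ.IsConvex) (htube : σ.HasTube c ε)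
    (h₁ : σ.IsDeformationOn c ε a b c₁) (h₂ : σ.IsDeformationOn c ε a b c₂) (hab : a ≤ b)
    (ha : c₁ a = c₂ a) (s : unitInterval) :
    dist (c₁ (Icc.convexComb a b s)) (c₂ (Icc.convexComb a b s)) ≤ s * dist (c₁ b) (c₂ b) := by
  simpa only [ha, dist_self, mul_zero, zero_add] using
    h₁.1.dist_convexComb_le hσ h₂.1 hab (h₁.exists_mem_ball h₂ htube) s

theorem exists_union (hσ : σ.IsConvex) (htube : σ.HasTube c ε)
    (h₁ : σ.IsDeformationOn c ε a v c₁) (h₂ : σ.IsDeformationOn c ε u b c₂) (hau : a ≤ u)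
    (huv : u < v) (hvb : v ≤ b) (hu : c₁ u = c₂ u) (hv : c₁ v = c₂ v) :
    ∃ c', σ.IsDeformationOn c ε a b c' ∧ EqOn c' c₁ (Icc a v) ∧ EqOn c' c₂ (Icc u b) := by
  have heq : EqOn c₁ c₂ (Icc u v) := (h₁.mono hau le_rfl).eqOn hσ htube (h₂.mono le_rfl hvb) hu hv
  let c' : unitInterval → X := fun t => if t ≤ v then c₁ t else c₂ t
  have hl : EqOn c' c₁ (Icc a v) := fun t ht => if_pos ht.2
  have hr : EqOn c' c₂ (Icc u b) := fun t ht => by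
    rcases le_or_gt t v with htv | hvt
    · exact (if_pos htv).trans (heq ⟨ht.1, htv⟩)
    · exact if_neg hvt.not_ge
  refine ⟨c', ⟨(h₁.1.congr_Icc hl).union_Icc (h₂.1.congr_Icc hr) huv, fun t ht => ?_⟩, hl, hr⟩
  rcases le_or_gt t v with htv | hvt
  · exact hl ⟨ht.1, htv⟩ ▸ h₁.2 t ⟨ht.1, htv⟩
  · have hut := (huv.trans hvt).le
    exact hr ⟨hut, ht.2⟩ ▸ h₂.2 t ⟨hut, ht.2⟩

end IsDeformationOn

namespace IsDeformableOn

theorem exists_matching [CompleteSpace X] (hσ : σ.IsConvex) (htube : σ.HasTube c ε)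
    (h₁ : σ.IsDeformableOn c ε a v) (h₂ : σ.IsDeformableOn c ε u b) (hau : a ≤ u) (huv : u < v)
    (hvb : v ≤ b) {y z : X} (hy : y ∈ closedBall (c a) ε) (hz : z ∈ closedBall (c b) ε) :
    ∃ c₁ c₂, σ.IsDeformationOn c ε a v c₁ ∧ σ.IsDeformationOn c ε u b c₂ ∧ c₁ a = y ∧ c₂ b = z ∧
      c₁ u = c₂ u ∧ c₁ v = c₂ v := by
  -- The matching point over `u` is the fixed point of `p ↦ γ (δ p v) u`, which is a contraction as
  -- the distance between two locally consistent curves from `y` shrinks from `v` to `u`.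
  choose! γ hγ hγa hγv using h₁ y hy
  choose! δ hδ hδu hδb using fun p hp => h₂ p hp z hz
  have hu : u ∈ Icc a v := ⟨hau, huv.le⟩
  have hv : v ∈ Icc u b := ⟨huv.le, hvb⟩
  have hδv : ∀ p ∈ closedBall (c u) ε, δ p v ∈ closedBall (c v) ε := fun p hp => (hδ p hp).2 v hv
  have hmaps : MapsTo (fun p => γ (δ p v) u) (closedBall (c u) ε) (closedBall (c u) ε) :=
    fun p hp => (hγ _ (hδv p hp)).2 u hu
  obtain ⟨s, hs⟩ := exists_convexComb_eq hu
  have hs₁ : (s : ℝ) < 1 := unitInterval.lt_one_iff_ne_one.2 fun h => by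
    rw [h, Icc.convexComb_one] at hs
    exact huv.ne' hs
  have hdist : ∀ p ∈ closedBall (c u) ε, ∀ q ∈ closedBall (c u) ε,
      dist (γ (δ p v) u) (γ (δ q v) u) ≤ s * dist p q := fun p hp q hq => by
    have hγdist := (hγ _ (hδv p hp)).dist_convexComb_le_of_eq_left hσ htube (hγ _ (hδv q hq))
      (hau.trans huv.le) ((hγa _ (hδv p hp)).trans (hγa _ (hδv q hq)).symm) s
    have hδdist := (hδ p hp).dist_le_of_eq_right hσ htube (hδ q hq)
      ((hδb p hp).trans (hδb q hq).symm) hv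
    rw [hs, hγv _ (hδv p hp), hγv _ (hδv q hq)] at hγdist
    rw [hδu p hp, hδu q hq] at hδdist
    exact hγdist.trans (mul_le_mul_of_nonneg_left hδdist s.2.1)
  have hcontr : ContractingWith (unitInterval.toNNReal s) (hmaps.restrict _ _ _) :=
    ⟨hs₁, LipschitzWith.of_dist_le_mul fun p q => hdist p p.2 q q.2⟩
  obtain ⟨p, hp, hfix, -⟩ := hcontr.exists_fixedPoint' isClosed_closedBall.isComplete hmaps
    (mem_closedBall_self (dist_nonneg.trans hy)) (edist_ne_top _ _)
  exact ⟨γ (δ p v), δ p, hγ _ (hδv p hp), hδ p hp, hγa _ (hδv p hp), hδb p hp,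
    hfix.eq.trans (hδu p hp).symm, hγv _ (hδv p hp)⟩

theorem union [CompleteSpace X] (hσ : σ.IsConvex) (htube : σ.HasTube c ε)
    (h₁ : σ.IsDeformableOn c ε a v) (h₂ : σ.IsDeformableOn c ε u b) (hau : a ≤ u) (huv : u < v)
    (hvb : v ≤ b) : σ.IsDeformableOn c ε a b := by
  intro y hy z hz
  obtain ⟨c₁, c₂, hc₁, hc₂, rfl, rfl, hu, hv⟩ :=
    h₁.exists_matching hσ htube h₂ hau huv hvb hy hz
  obtain ⟨c', hc', hl, hr⟩ := hc₁.exists_union hσ htube hc₂ hau huv hvb hu hv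
  exact ⟨c', hc', hl ⟨le_rfl, hau.trans huv.le⟩, hr ⟨huv.le.trans hvb, le_rfl⟩⟩

theorem of_short [CompleteSpace X] (hσ : σ.IsConvex) (htube : σ.HasTube c ε) {η : ℝ} (hη : 0 < η)
    (hshort : ∀ a b : unitInterval, a < b → (b : ℝ) - a ≤ η → σ.IsDeformableOn c ε a b)
    (hab : a < b) : σ.IsDeformableOn c ε a b := by
  suffices h : ∀ (n : ℕ) (b : unitInterval), a < b → (b : ℝ) - a ≤ η + n * (η / 2) →
      σ.IsDeformableOn c ε a b by
    obtain ⟨n, hn⟩ := exists_nat_ge (((b : ℝ) - a) / (η / 2))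
    exact h n b hab (by linarith [(div_le_iff₀ (half_pos hη)).1 hn])
  intro n
  induction n with
  | zero => exact fun b hab hle => hshort a b hab (by simpa using hle)
  | succ n ih =>
    intro b hab hle
    rcases le_or_gt ((b : ℝ) - a) η with hlen | hlen
    · exact hshort a b hab hlen
    have ha := a.2.1
    have hb := b.2.2
    let u : unitInterval := ⟨b - η, by linarith, by linarith⟩
    let v : unitInterval := ⟨b - η / 2, by linarith, by linarith⟩
    have hau : a < u := show (a : ℝ) < b - η by linarith
    have huv : u < v := show (b : ℝ) - η < b - η / 2 by linarith
    have hvb : v < b := show (b : ℝ) - η / 2 < b by linarith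
    have hav : (b : ℝ) - η / 2 - a ≤ η + n * (η / 2) := by
      push_cast at hle
      linarith
    have hub : (b : ℝ) - u ≤ η := (sub_sub_cancel _ _).le
    exact (ih v (hau.trans huv) hav).union hσ htube (hshort u b (huv.trans hvb) hub) hau.le huv
      hvb.le

end IsDeformableOn

theorem IsLocallyConsistent.exists_deformation [CompleteSpace X] (hσ : σ.IsConvex)
    (hc : σ.IsLocallyConsistent c) : ∃ ε > 0, σ.HasTube c ε ∧
      ∀ y z, dist y (c 0) ≤ ε → dist z (c 1) ≤ ε → ∃ c', σ.IsLocallyConsistent c' ∧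
        c' 0 = y ∧ c' 1 = z ∧
        ∀ t : unitInterval, dist (c' t) (c t) ≤ (1 - t) * dist y (c 0) + t * dist z (c 1) := by
  obtain ⟨ε, hε, htube, η, hη, hshort⟩ := σ.exists_hasTube hc.1
  have hdef : σ.IsDeformableOn c ε 0 1 :=
    .of_short hσ htube hη (fun a b hab hle =>
      (hshort a b hle).elim fun _ hx => (hc.isLocallyConsistentOn _).isDeformableOn hσ hab hx)
      zero_lt_one
  refine ⟨ε, hε, htube, fun y z hy hz => ?_⟩
  obtain ⟨c', ⟨hc', hnear⟩, rfl, rfl⟩ := hdef y hy z hz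
  rw [Icc_zero_one] at hc' hnear
  rw [isLocallyConsistentOn_univ] at hc'
  exact ⟨c', hc', rfl, rfl, hc'.dist_le hσ hc fun t =>
    htube t _ (hnear t (mem_univ t)) _ (mem_closedBall_self hε.le)⟩

end LocalGeodesicBicombing

/-! ### Path lifting for local isometries -/

section Lipschitz

variable {Y : Type*} [PseudoMetricSpace Y]

theorem dist_add_dist_unitInterval {s t u : unitInterval} (hst : s ≤ t) (htu : t ≤ u) :
    dist s t + dist t u = dist s u :=
  dist_add_dist_of_mem_segment (y := (t : ℝ)) <| by
    rw [segment_eq_Icc (Subtype.coe_le_coe.2 (hst.trans htu))]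
    exact ⟨hst, htu⟩

theorem dist_le_of_eventually_dist_le {f : unitInterval → Y} {K : ℝ} {a b : unitInterval}
    (hab : a ≤ b)
    (loc : ∀ t ∈ Icc a b, ∀ᶠ s in 𝓝[Icc a b] t, dist (f s) (f t) ≤ K * dist s t) :
    dist (f a) (f b) ≤ K * dist a b := by
  refine rel_of_eventually_rel_Icc (P := fun s t => dist (f s) (f t) ≤ K * dist s t) hab
    (fun s t has hst _ hs ht => ?_)
    fun t ht => (loc t ht).mono fun s hs => ⟨fun _ => hs, fun _ => ?_⟩
  · rw [← dist_add_dist_unitInterval has hst, mul_add]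
    exact (dist_triangle _ _ _).trans (add_le_add hs ht)
  · rwa [dist_comm (f t), dist_comm t]

theorem lipschitzWith_of_eventually_dist_le {f : unitInterval → Y} {K : NNReal}
    (loc : ∀ t, ∀ᶠ s in 𝓝 t, dist (f s) (f t) ≤ K * dist s t) : LipschitzWith K f := by
  refine LipschitzWith.of_dist_le_mul fun s t => ?_
  wlog hst : s ≤ t generalizing s t
  · rw [dist_comm (f s), dist_comm s]
    exact this t s (le_of_not_ge hst)
  exact dist_le_of_eventually_dist_le hst fun u _ => mem_nhdsWithin_of_mem_nhds (loc u)

end Lipschitz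

/-- `g` lifts the curve `γ` through `p` over `S`. -/
def IsLiftOn {E X : Type*} [TopologicalSpace E] (p : E → X) (γ : unitInterval → X)
    (S : Set unitInterval) (g : unitInterval → E) : Prop :=
  ContinuousOn g S ∧ ∀ t ∈ S, p (g t) = γ t

namespace IsLiftOn

section

variable {E X : Type*} [TopologicalSpace E] {p : E → X} {γ : unitInterval → X}
  {g g₁ g₂ : unitInterval → E} {S T : Set unitInterval} {a b d : unitInterval}

theorem mono (hg : IsLiftOn p γ T g) (h : S ⊆ T) : IsLiftOn p γ S g :=
  ⟨hg.1.mono h, fun t ht => hg.2 t (h ht)⟩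

theorem exists_union (h₁ : IsLiftOn p γ (Icc a b) g₁) (h₂ : IsLiftOn p γ (Icc b d) g₂)
    (hab : a ≤ b) (hbd : b ≤ d) (hb : g₁ b = g₂ b) :
    ∃ g, IsLiftOn p γ (Icc a d) g ∧ g a = g₁ a := by
  let g : unitInterval → E := fun t => if t ≤ b then g₁ t else g₂ t
  have hl : EqOn g g₁ (Icc a b) := fun t ht => if_pos ht.2
  have hr : EqOn g g₂ (Icc b d) := fun t ht => by
    rcases ht.1.eq_or_lt with rfl | hbt
    · exact (if_pos le_rfl).trans hb
    · exact if_neg hbt.not_ge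
  refine ⟨g, ?_, hl (left_mem_Icc.2 hab)⟩
  rw [← Icc_union_Icc_eq_Icc hab hbd]
  refine ⟨(h₁.1.congr hl).union_of_isClosed (h₂.1.congr hr) isClosed_Icc isClosed_Icc, ?_⟩
  rintro t (ht | ht)
  · rw [hl ht, h₁.2 t ht]
  · rw [hr ht, h₂.2 t ht]

theorem eqOn_Icc [TopologicalSpace X] [T2Space E] (hp : IsLocalHomeomorph p)
    (h₁ : IsLiftOn p γ (Icc a b) g₁) (h₂ : IsLiftOn p γ (Icc a b) g₂) (ha : g₁ a = g₂ a) :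
    EqOn g₁ g₂ (Icc a b) := fun _ ht =>
  (T2Space.isSeparatedMap p).eqOn_of_comp_eqOn hp.isLocallyInjective isPreconnected_Icc h₁.1 h₂.1
    (fun t ht => (h₁.2 t ht).trans (h₂.2 t ht).symm) (left_mem_Icc.2 (ht.1.trans ht.2)) ha ht

end

end IsLiftOn

theorem eventually_exists_isLiftOn_Icc {E X : Type*} [TopologicalSpace E] [TopologicalSpace X]
    {p : E → X} (hp : IsLocalHomeomorph p) {γ : unitInterval → X} (hγ : Continuous γ)
    {t : unitInterval} {e : E} (he : p e = γ t) :
    ∀ᶠ u in 𝓝[≥] t, ∃ g, IsLiftOn p γ (Icc t u) g ∧ g t = e := by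
  obtain ⟨f, hef, rfl⟩ := hp e
  have hmem : γ t ∈ f.target := he ▸ f.map_source hef
  have hnhds : γ ⁻¹' f.target ∈ 𝓝 t := hγ.continuousAt (f.open_target.mem_nhds hmem)
  obtain ⟨a, b, htab, hab, hsub⟩ := exists_Icc_mem_subset_of_mem_nhds hnhds
  filter_upwards [mem_nhdsWithin_of_mem_nhds hab] with u hu
  have hsub : MapsTo γ (Icc t u) f.target := fun s hs => hsub ⟨htab.1.trans hs.1, hs.2.trans hu.2⟩
  refine ⟨f.symm ∘ γ, ⟨f.continuousOn_symm.comp hγ.continuousOn hsub, fun s hs =>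
    f.right_inv (hsub hs)⟩, ?_⟩
  rw [Function.comp_apply, ← he, f.left_inv hef]

/-- A map that maps a ball around each point isometrically onto a ball. -/
def IsLocalIsometry {E X : Type*} [MetricSpace E] [MetricSpace X] (p : E → X) : Prop :=
  ∀ c, ∃ ε > 0, (∀ a ∈ ball c ε, ∀ b ∈ ball c ε, dist (p a) (p b) = dist a b) ∧
    ball (p c) ε ⊆ p '' ball c ε

namespace IsLocalIsometry

variable {E X : Type*} [MetricSpace E] [MetricSpace X] {p : E → X} {γ : unitInterval → X}
  {K : NNReal}

theorem isLocalHomeomorph (hp : IsLocalIsometry p) : IsLocalHomeomorph p := by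
  rw [isLocalHomeomorph_iff_isOpenEmbedding_restrict]
  intro c
  obtain ⟨ε, hε, hiso, hsurj⟩ := hp c
  have hrange : range ((ball c ε).domRestrict p) = ball (p c) ε := by
    rw [range_domRestrict]
    refine Subset.antisymm ?_ hsurj
    rintro _ ⟨a, ha, rfl⟩
    rwa [mem_ball, hiso a ha c (mem_ball_self hε)]
  exact ⟨ball c ε, ball_mem_nhds c hε,
    (Isometry.of_dist_eq (f := (ball c ε).domRestrict p) fun a b =>
      hiso a a.2 b b.2).isEmbedding, hrange ▸ isOpen_ball⟩

theorem lipschitzOnWith_lift (hp : IsLocalIsometry p) (hγ : LipschitzWith K γ)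
    {a b : unitInterval} {g : unitInterval → E} (hg : IsLiftOn p γ (Icc a b) g) :
    LipschitzOnWith K g (Icc a b) := by
  refine LipschitzOnWith.of_dist_le_mul fun s hs t ht => ?_
  wlog hst : s ≤ t generalizing s t
  · rw [dist_comm (g s), dist_comm s]
    exact this t ht s hs (le_of_not_ge hst)
  replace hg := hg.mono (Icc_subset_Icc hs.1 ht.2)
  refine dist_le_of_eventually_dist_le hst fun u hu => ?_
  obtain ⟨ε, hε, hiso, -⟩ := hp (g u)
  filter_upwards [hg.1 u hu (ball_mem_nhds (g u) hε), self_mem_nhdsWithin] with v hv hvst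
  rw [← hiso _ hv _ (mem_ball_self hε), hg.2 v hvst, hg.2 u hu]
  exact hγ.dist_le_mul v u

theorem exists_isLiftOn_of_forall_lt [CompleteSpace E] (hp : IsLocalIsometry p)
    (hγ : LipschitzWith K γ) {e : E} {m : unitInterval} (hm : 0 < m)
    (h : ∀ t < m, ∃ g, IsLiftOn p γ (Icc 0 t) g ∧ g 0 = e) :
    ∃ g, IsLiftOn p γ (Icc 0 m) g ∧ g 0 = e := by
  have : Nonempty E := ⟨e⟩
  choose! g hg hg₀ using h
  let f : unitInterval → E := fun t => g t t
  have hfg : ∀ t < m, EqOn f (g t) (Icc 0 t) := fun t ht s hs =>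
    (hg s (hs.2.trans_lt ht)).eqOn_Icc hp.isLocalHomeomorph
      ((hg t ht).mono (Icc_subset_Icc_right hs.2))
      ((hg₀ s (hs.2.trans_lt ht)).trans (hg₀ t ht).symm) (right_mem_Icc.2 hs.1)
  have hf : LipschitzOnWith K f (Iio m) := fun s hs t ht => by
    have hmax : max s t < m := max_lt hs ht
    have hs' : s ∈ Icc 0 (max s t) := ⟨unitInterval.nonneg', le_max_left s t⟩
    have ht' : t ∈ Icc 0 (max s t) := ⟨unitInterval.nonneg', le_max_right s t⟩
    rw [hfg _ hmax hs', hfg _ hmax ht']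
    exact hp.lipschitzOnWith_lift hγ (hg _ hmax) hs' ht'
  have : (𝓝[<] m).NeBot := nhdsLT_neBot_of_exists_lt ⟨0, hm⟩
  have hcauchy : Cauchy (map f (𝓝[<] m)) :=
    (cauchy_nhds.mono nhdsWithin_le_nhds).map_of_le hf.uniformContinuousOn
      (le_principal_iff.2 self_mem_nhdsWithin)
  obtain ⟨y, hy : Tendsto f (𝓝[<] m) (𝓝 y)⟩ := CompleteSpace.complete hcauchy
  have hpf : ∀ t < m, p (f t) = γ t := fun t ht =>
    (hg t ht).2 t (right_mem_Icc.2 unitInterval.nonneg')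
  have hpy : p y = γ m := tendsto_nhds_unique
    ((hp.isLocalHomeomorph.continuous.tendsto y).comp hy)
    (hγ.continuous.continuousWithinAt.congr' (eventually_mem_nhdsWithin.mono fun t ht =>
      (hpf t ht).symm))
  refine ⟨Function.update f m y, ⟨?_, fun t ht => ?_⟩, ?_⟩
  · rw [continuousOn_update_iff, Icc_sdiff_right]
    refine ⟨hf.continuousOn.mono fun t ht => ht.2, fun _ => hy.mono_left ?_⟩
    exact nhdsWithin_mono m fun t ht => ht.2
  · rcases ht.2.eq_or_lt with rfl | htm
    · rwa [Function.update_self]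
    · rw [Function.update_of_ne htm.ne, hpf t htm]
  · rw [Function.update_of_ne hm.ne]
    exact hg₀ 0 hm

theorem isClosed_exists_isLiftOn [CompleteSpace E] (hp : IsLocalIsometry p)
    (hγ : LipschitzWith K γ) {e : E} (he : p e = γ 0) :
    IsClosed {t | ∃ g, IsLiftOn p γ (Icc 0 t) g ∧ g 0 = e} := by
  refine isClosed_of_closure_subset fun m hm => ?_
  rcases eq_or_ne m 0 with rfl | hm₀
  · exact (eventually_exists_isLiftOn_Icc hp.isLocalHomeomorph hγ.continuous he).self_of_nhdsWithin
      self_mem_Ici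
  refine hp.exists_isLiftOn_of_forall_lt hγ (bot_lt_iff_ne_bot.2 hm₀) fun t ht => ?_
  obtain ⟨u, htu, g, hg, hge⟩ := mem_closure_iff.1 hm _ isOpen_Ioi ht
  exact ⟨g, hg.mono (Icc_subset_Icc_right (le_of_lt htu)), hge⟩

theorem exists_lift_of_lipschitzWith [CompleteSpace E] (hp : IsLocalIsometry p)
    (hγ : LipschitzWith K γ) {e : E} (he : p e = γ 0) :
    ∃ g : C(unitInterval, E), g 0 = e ∧ ∀ t, p (g t) = γ t := by
  have hloc {t : unitInterval} {e : E} (he : p e = γ t) :=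
    eventually_exists_isLiftOn_Icc hp.isLocalHomeomorph hγ.continuous he
  have hsub : Icc 0 1 ⊆ {t | ∃ g, IsLiftOn p γ (Icc 0 t) g ∧ g 0 = e} := by
    refine ((hp.isClosed_exists_isLiftOn hγ he).inter isClosed_Icc).Icc_subset_of_forall_exists_gt
      ((hloc he).self_of_nhdsWithin self_mem_Ici) ?_
    rintro t ⟨⟨g, hg, hge⟩, ht₀, ht₁⟩ y hy
    have : (𝓝[>] t).NeBot := nhdsGT_neBot_of_exists_gt ⟨1, ht₁⟩
    obtain ⟨u, ⟨g', hg', hgg'⟩, hu⟩ := (((hloc (hg.2 t (right_mem_Icc.2 ht₀))).filter_mono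
      (nhdsWithin_mono t Ioi_subset_Ici_self)).and (Ioc_mem_nhdsGT hy)).exists
    obtain ⟨g'', hg'', hgg''⟩ := hg.exists_union hg' ht₀ hu.1.le hgg'.symm
    exact ⟨u, ⟨g'', hg'', hgg''.trans hge⟩, hu⟩
  obtain ⟨g, hg, hge⟩ := hsub (right_mem_Icc.2 zero_le_one)
  rw [Icc_zero_one] at hg
  exact ⟨⟨g, continuousOn_univ.1 hg.1⟩, hge, fun t => hg.2 t (mem_univ t)⟩

end IsLocalIsometry

/-- Every path in `X` lifts through `p`, from any point over its starting point. -/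
def HasPathLifting {E X : Type*} [TopologicalSpace E] [TopologicalSpace X] (p : E → X) : Prop :=
  ∀ (γ : C(unitInterval, X)) (e : E), p e = γ 0 →
    ∃ g : C(unitInterval, E), g 0 = e ∧ ∀ t, p (g t) = γ t

namespace HasPathLifting

variable {E X : Type*} [TopologicalSpace E] [TopologicalSpace X] {p : E → X}

theorem surjective [PathConnectedSpace X] [Nonempty E] (hp : HasPathLifting p) :
    Function.Surjective p := fun y => by
  obtain ⟨e⟩ := ‹Nonempty E›
  have γ := PathConnectedSpace.somePath (p e) y
  obtain ⟨g, -, hg⟩ := hp γ e γ.source.symm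
  exact ⟨g 1, (hg 1).trans γ.target⟩

theorem injective [SimplyConnectedSpace X] [PathConnectedSpace E] [T2Space E]
    (hp : HasPathLifting p) (hloc : IsLocalHomeomorph p) : Function.Injective p := fun a b hab => by
  obtain ⟨e⟩ : Nonempty E := inferInstance
  have A := PathConnectedSpace.somePath e a
  have B := PathConnectedSpace.somePath e b
  obtain ⟨H⟩ := SimplyConnectedSpace.paths_homotopic (A.map hloc.continuous)
    ((B.map hloc.continuous).cast rfl hab)
  choose Γ hΓe hΓ using fun t => hp ⟨fun s => H (t, s), by fun_prop⟩ e (H.source t).symm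
  have hlift {t : unitInterval} {y : E} (C : Path e y) (hC : ∀ s, H (t, s) = p (C s)) :
      Γ t 1 = y := by
    have := (T2Space.isSeparatedMap p).eq_of_comp_eq hloc.isLocallyInjective (Γ t).continuous
      C.continuous (funext fun s => (hΓ t s).trans (hC s)) 0 ((hΓe t).trans C.source.symm)
    rw [this, C.target]
  rw [← hlift A fun s => H.apply_zero s, ← hlift B fun s => H.apply_one s]
  exact (hloc.monodromy_theorem (T2Space.isSeparatedMap p) H Γ hΓ
    (fun t => (hΓe t).trans (hΓe 0).symm) 1).symm

end HasPathLifting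

namespace LocalGeodesicBicombing

variable {X : Type*} [MetricSpace X] {σ : LocalGeodesicBicombing X}

theorem lipschitzWith_seg {y z : X} (h : (y, z) ∈ localDomain σ.r) :
    LipschitzWith (nndist y z) (σ.seg y z) :=
  LipschitzWith.of_dist_le_mul fun s t => by
    rw [(σ.isGeodesic y z h).2 s t, σ.source y z h, σ.target y z h, mul_comm, coe_nndist,
      Subtype.dist_eq, Real.dist_eq]

theorem IsConvex.continuous_seg_prod (hσ : σ.IsConvex) {x y : X} (hy : y ∈ ball x (σ.r x)) :
    Continuous fun q : unitInterval × ball x (σ.r x) => σ.seg y q.2 q.1 := by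
  refine continuous_prod_of_continuous_lipschitzWith' _ 1 (fun t => ?_) (fun z => ?_)
  · refine LipschitzWith.of_dist_le_mul fun z z' => ?_
    refine (hσ.dist_seg_le hy z.2 hy z'.2 t).trans ?_
    rw [dist_self, mul_zero, zero_add]
    exact mul_le_mul_of_nonneg_right t.2.2 dist_nonneg
  · exact (σ.isGeodesic y z (mem_localDomain hy z.2)).1

variable {E : Type*} [MetricSpace E] [CompleteSpace E] {p : E → X}

theorem IsConvex.exists_section (hσ : σ.IsConvex) (hp : IsLocalIsometry p) {e : E} {x : X}
    (he : p e ∈ ball x (σ.r x)) :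
    ∃ s : X → E, ContinuousOn s (ball x (σ.r x)) ∧ RightInvOn s p (ball x (σ.r x)) ∧
      s (p e) = e := by
  have hd {z : X} (hz : z ∈ ball x (σ.r x)) := mem_localDomain he hz
  have : Nonempty C(unitInterval, E) := ⟨.const _ e⟩
  choose! g hge hg using fun z (hz : z ∈ ball x (σ.r x)) =>
    hp.exists_lift_of_lipschitzWith (lipschitzWith_seg (hd hz)) (σ.source _ _ (hd hz)).symm
  have hcont : Continuous fun q : unitInterval × ball x (σ.r x) => g q.2 q.1 :=
    hp.isLocalHomeomorph.continuous_lift (T2Space.isSeparatedMap p)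
      ⟨_, hσ.continuous_seg_prod he⟩ (funext fun q => hg q.2 q.2.2 q.1)
      (continuous_const.congr fun z => (hge z z.2).symm) fun z => (g z).continuous
  refine ⟨fun z => g z 1, ?_, fun z hz => (hg z hz 1).trans (σ.target _ _ (hd hz)), ?_⟩
  · rw [continuousOn_iff_continuous_domRestrict]
    exact hcont.comp (Continuous.prodMk_right 1)
  · have := (T2Space.isSeparatedMap p).const_of_comp hp.isLocalHomeomorph.isLocallyInjective
      (g (p e)).continuous (fun t t' => by rw [hg _ he, hg _ he, σ.seg_self, σ.seg_self]) 1 0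
    exact this.trans (hge _ he)

theorem IsConvex.hasPathLifting (hσ : σ.IsConvex) (hp : IsLocalIsometry p) : HasPathLifting p := by
  intro γ e he
  have hlift : ∀ e, p e = γ 0 → ∃ g, IsLiftOn p γ (Icc 0 1) g ∧ g 0 = e := by
    refine rel_of_eventually_rel_Icc (P := fun a b => ∀ e, p e = γ a →
      ∃ g, IsLiftOn p γ (Icc a b) g ∧ g a = e) zero_le_one
      (fun s t hs hst _ h₁ h₂ e he => ?_) fun t _ => ?_
    · obtain ⟨g₁, hg₁, rfl⟩ := h₁ e he
      obtain ⟨g₂, hg₂, hgg⟩ := h₂ (g₁ s) (hg₁.2 s (right_mem_Icc.2 hs))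
      exact hg₁.exists_union hg₂ hs hst hgg.symm
    · obtain ⟨a, b, hta, hab, hsub⟩ := exists_Icc_mem_subset_of_mem_nhds
        (γ.continuous.continuousAt (isOpen_ball.mem_nhds (σ.mem_ball_self (γ t))))
      have hP : ∀ u ∈ Icc a b, ∀ v ∈ Icc a b, ∀ e, p e = γ u →
          ∃ g, IsLiftOn p γ (Icc u v) g ∧ g u = e := fun u hu v hv e he => by
        obtain ⟨s, hs, hps, hse⟩ := hσ.exists_section hp (mem_of_eq_of_mem he (hsub hu))
        have hmaps : MapsTo γ (Icc u v) (ball (γ t) (σ.r (γ t))) := fun w hw =>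
          hsub ⟨hu.1.trans hw.1, hw.2.trans hv.2⟩
        exact ⟨s ∘ γ, ⟨hs.comp γ.continuous.continuousOn hmaps, fun w hw => hps (hmaps hw)⟩,
          (congrArg s he.symm).trans hse⟩
      filter_upwards [mem_nhdsWithin_of_mem_nhds hab] with s hs
      exact ⟨fun _ => hP s hs t hta, fun _ => hP t hta s hs⟩
  obtain ⟨g, hg, hge⟩ := hlift e he
  rw [Icc_zero_one] at hg
  exact ⟨⟨g, continuousOn_univ.1 hg.1⟩, hge, fun t => hg.2 t (mem_univ t)⟩

theorem IsConvex.bijective_of_isLocalIsometry (hσ : σ.IsConvex) [SimplyConnectedSpace X]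
    [PathConnectedSpace E] (hp : IsLocalIsometry p) : Function.Bijective p :=
  have hlift := hσ.hasPathLifting hp
  ⟨hlift.injective hp.isLocalHomeomorph, hlift.surjective⟩

end LocalGeodesicBicombing

/-! ### The endpoint map -/

namespace LocalGeodesicBicombing

variable {X : Type*} [MetricSpace X] {σ : LocalGeodesicBicombing X}

/-- The space of locally consistent curves that start at `x`, with the metric of uniform
convergence. -/
abbrev CurvesFrom (σ : LocalGeodesicBicombing X) (x : X) : Type _ :=
  {c : C(unitInterval, X) // σ.IsLocallyConsistent c ∧ c 0 = x}

namespace CurvesFrom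

variable {x : X}

/-- The endpoint map, which plays the role of the exponential map at `x`. -/
def endpoint (c : σ.CurvesFrom x) : X := c.1 1

theorem dist_endpoint (hσ : σ.IsConvex) (a b : σ.CurvesFrom x)
    (h : ∀ t, ∃ z, a.1 t ∈ ball z (σ.r z) ∧ b.1 t ∈ ball z (σ.r z)) :
    dist a.endpoint b.endpoint = dist a b := by
  refine le_antisymm (ContinuousMap.dist_apply_le_dist (f := a.1) (g := b.1) 1)
    ((ContinuousMap.dist_le dist_nonneg).2 fun t => ?_)
  have hdist := a.2.1.dist_le hσ b.2.1 h t
  rw [a.2.2, b.2.2, dist_self, mul_zero, zero_add] at hdist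
  exact hdist.trans (mul_le_of_le_one_left dist_nonneg t.2.2)

/-- The constant curve. -/
def const (σ : LocalGeodesicBicombing X) (x : X) : σ.CurvesFrom x :=
  ⟨ContinuousMap.const _ x, σ.isLocallyConsistent_const x, rfl⟩

theorem joined_const (c : σ.CurvesFrom x) : Joined (const σ x) c := by
  let F : C(unitInterval × unitInterval, X) :=
    ⟨fun q => c.1 (Icc.convexComb 0 q.1 q.2), c.1.continuous.comp (by fun_prop)⟩
  have hF : ∀ t, σ.IsLocallyConsistent (F.curry t) ∧ F.curry t 0 = x := fun t =>
    ⟨c.2.1.comp_convexComb bot_le, by simp [F, c.2.2]⟩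
  exact ⟨⟨⟨fun t => ⟨F.curry t, hF t⟩, F.curry.continuous.subtype_mk _⟩,
    Subtype.ext (ContinuousMap.ext fun t => by simp [F, const, c.2.2]),
    Subtype.ext (ContinuousMap.ext fun t => by simp [F])⟩⟩

end CurvesFrom

theorem pathConnectedSpace_curvesFrom (σ : LocalGeodesicBicombing X) (x : X) :
    PathConnectedSpace (σ.CurvesFrom x) :=
  ⟨⟨CurvesFrom.const σ x⟩, fun a b => a.joined_const.symm.trans b.joined_const⟩

namespace IsConvex

variable [CompleteSpace X]

theorem completeSpace_curvesFrom (hσ : σ.IsConvex) (x : X) : CompleteSpace (σ.CurvesFrom x) :=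
  (hσ.isClosed_isLocallyConsistent.inter
    (isClosed_eq (continuous_eval_const 0) continuous_const)).completeSpace_coe

theorem isLocalIsometry_endpoint (hσ : σ.IsConvex) (x : X) :
    IsLocalIsometry (CurvesFrom.endpoint : σ.CurvesFrom x → X) := by
  intro c
  obtain ⟨ε, hε, htube, hdef⟩ := c.2.1.exists_deformation hσ
  have hnear : ∀ a ∈ ball c ε, ∀ t, a.1 t ∈ closedBall (c.1 t) ε := fun a ha t =>
    (ContinuousMap.dist_apply_le_dist (f := a.1) (g := c.1) t).trans (le_of_lt ha)
  have hx : dist x (c.1 0) = 0 := by rw [c.2.2, dist_self]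
  refine ⟨ε, hε, fun a ha b hb => a.dist_endpoint hσ b fun t =>
    htube t _ (hnear a ha t) _ (hnear b hb t), fun y hy => ?_⟩
  obtain ⟨c', hc', h₀, h₁, hdist⟩ := hdef x y (hx.trans_le hε.le) (le_of_lt hy)
  refine ⟨⟨⟨c', hc'.1⟩, hc', h₀⟩, ?_, h₁⟩
  refine lt_of_le_of_lt ((ContinuousMap.dist_le dist_nonneg).2 fun t => (hdist t).trans ?_) hy
  rw [hx, mul_zero, zero_add]
  exact mul_le_of_le_one_left dist_nonneg t.2.2

theorem bijective_endpoint [SimplyConnectedSpace X] (hσ : σ.IsConvex) (x : X) :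
    Function.Bijective (CurvesFrom.endpoint : σ.CurvesFrom x → X) :=
  have := hσ.completeSpace_curvesFrom x
  have := σ.pathConnectedSpace_curvesFrom x
  hσ.bijective_of_isLocalIsometry (hσ.isLocalIsometry_endpoint x)

end IsConvex

end LocalGeodesicBicombing

/-! ### Speed and length -/

/-- The curve `c` moves with constant speed `w` near `t`. -/
def HasSpeedAt {X : Type*} [PseudoMetricSpace X] (c : unitInterval → X) (w : ℝ)
    (t : unitInterval) : Prop :=
  ∀ᶠ p : unitInterval × unitInterval in 𝓝 (t, t), dist (c p.1) (c p.2) = w * dist p.1 p.2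

/-- The curve `c` moves locally with constant speed `w`; unlike a geodesic, it need not minimize the
distance globally. -/
def HasSpeed {X : Type*} [PseudoMetricSpace X] (c : unitInterval → X) (w : ℝ) : Prop :=
  ∀ t, HasSpeedAt c w t

section Speed

variable {X : Type*} [PseudoMetricSpace X] {c c' : unitInterval → X} {w w' : ℝ}

namespace HasSpeedAt

variable {t : unitInterval}

theorem eventually_dist_eq (h : HasSpeedAt c w t) :
    ∀ᶠ s in 𝓝 t, dist (c s) (c t) = w * dist s t :=
  (Continuous.tendsto' (f := fun s => (s, t)) (by fun_prop) t (t, t) rfl).eventually h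

theorem eventually_hasSpeedAt (h : HasSpeedAt c w t) : ∀ᶠ s in 𝓝 t, HasSpeedAt c w s :=
  (Continuous.tendsto' (f := fun s => (s, s)) (by fun_prop) t (t, t) rfl).eventually
    (eventually_eventually_nhds.2 h)

theorem abs_sub_le (h : HasSpeedAt c w t) (h' : HasSpeedAt c' w' t) (heq : c t = c' t) {d : ℝ}
    (hd : ∀ s, dist (c s) (c' s) ≤ d * dist s t) : |w - w'| ≤ d := by
  obtain ⟨s, ⟨hs, hs'⟩, hst : s ≠ t⟩ := ((h.eventually_dist_eq.and
    h'.eventually_dist_eq).filter_mono nhdsWithin_le_nhds |>.and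
      (self_mem_nhdsWithin : {t}ᶜ ∈ 𝓝[≠] t)).exists
  refine le_of_mul_le_mul_right ?_ (dist_pos.2 hst)
  rw [← abs_of_nonneg (dist_nonneg (x := s) (y := t)), ← abs_mul, sub_mul, ← hs, ← hs', heq,
    abs_of_nonneg dist_nonneg]
  exact (abs_dist_sub_le _ _ _).trans (hd s)

theorem unique (h : HasSpeedAt c w t) (h' : HasSpeedAt c w' t) : w = w' :=
  sub_eq_zero.1 (abs_nonpos_iff.1 (h.abs_sub_le h' rfl fun s => by rw [dist_self, zero_mul]))

theorem nonneg (h : HasSpeedAt c w t) : 0 ≤ w := by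
  have habs : HasSpeedAt c |w| t := h.mono fun p hp => by
    rw [← abs_of_nonneg (dist_nonneg (x := c p.1)), hp, abs_mul, abs_of_nonneg dist_nonneg]
  exact h.unique habs ▸ abs_nonneg w

theorem exists_hasSpeed (h : ∀ t, ∃ w, HasSpeedAt c w t) : ∃ w, HasSpeed c w := by
  choose w hw using h
  have hconst : IsLocallyConstant w := (IsLocallyConstant.iff_eventually_eq w).2 fun t =>
    (hw t).eventually_hasSpeedAt.mono fun s hs => (hw s).unique hs
  exact ⟨w 0, fun t => hconst.apply_eq_of_preconnectedSpace t 0 ▸ hw t⟩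

end HasSpeedAt

namespace HasSpeed

theorem nonneg (h : HasSpeed c w) : 0 ≤ w :=
  (h 0).nonneg

theorem lipschitzWith (h : HasSpeed c w) : LipschitzWith w.toNNReal c :=
  lipschitzWith_of_eventually_dist_le fun t => (h t).eventually_dist_eq.mono fun s hs => by
    rw [Real.coe_toNNReal w h.nonneg, hs]

theorem unique (h : HasSpeed c w) (h' : HasSpeed c w') : w = w' :=
  (h 0).unique (h' 0)

theorem comp_convexComb (h : HasSpeed c w) (a b : unitInterval) :
    HasSpeed (fun t => c (Icc.convexComb a b t)) (w * dist a b) := by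
  intro t
  have hlim : Tendsto (fun p : unitInterval × unitInterval =>
      (Icc.convexComb a b p.1, Icc.convexComb a b p.2)) (𝓝 (t, t))
      (𝓝 (Icc.convexComb a b t, Icc.convexComb a b t)) :=
    Continuous.tendsto' (by fun_prop) _ _ rfl
  refine (hlim.eventually (h _)).mono fun p hp => ?_
  rw [hp, dist_convexComb, mul_assoc]

end HasSpeed

theorem hasSpeed_const (x : X) : HasSpeed (fun _ => x) 0 := fun _ =>
  .of_forall fun _ => by rw [dist_self, zero_mul]

end Speed

section Length

variable {X : Type*} [MetricSpace X]

theorem eVariationOn_id_unitInterval :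
    eVariationOn (id : unitInterval → unitInterval) univ = 1 := by
  have h := MonotoneOn.eVariationOn_eq (f := ((↑) : unitInterval → ℝ)) (s := univ) (a := 0) (b := 1)
    (fun _ _ _ _ h => h) (mem_univ _) (mem_univ _)
  rw [univ_inter, Icc_zero_one, Icc.coe_one, Icc.coe_zero, sub_zero, ENNReal.ofReal_one] at h
  exact h

theorem curveLength_le_of_lipschitzWith {x y : X} (γ : Path x y) {K : NNReal}
    (hγ : LipschitzWith K γ) : curveLength γ ≤ K := by
  have h := hγ.lipschitzOnWith.comp_eVariationOn_le (g := id) (mapsTo_univ _ univ)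
  rwa [Function.comp_id, eVariationOn_id_unitInterval, mul_one] at h

theorem edist_le_inducedLengthEDist_of_eventually {Y : Type*} [PseudoEMetricSpace Y] {f : X → Y}
    (loc : ∀ y, ∀ᶠ z in 𝓝 y, edist (f z) (f y) ≤ edist z y) (x y : X) :
    edist (f x) (f y) ≤ inducedLengthEDist x y := by
  refine le_iInf fun γ => ?_
  have h : edist (f (γ 0)) (f (γ 1)) ≤ eVariationOn γ (univ ∩ Icc 0 1) := by
    refine rel_of_eventually_rel_Icc
      (P := fun s t => edist (f (γ s)) (f (γ t)) ≤ eVariationOn γ (univ ∩ Icc s t)) zero_le_one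
      (fun s t hs hst _ h₁ h₂ => ?_) fun t _ => ?_
    · rw [← eVariationOn.Icc_add_Icc γ hs hst (mem_univ s)]
      exact (edist_triangle _ _ _).trans (add_le_add h₁ h₂)
    · have hvar {u v : unitInterval} (huv : u ≤ v) :
          edist (γ u) (γ v) ≤ eVariationOn γ (univ ∩ Icc u v) :=
        eVariationOn.edist_le γ ⟨mem_univ u, left_mem_Icc.2 huv⟩ ⟨mem_univ v, right_mem_Icc.2 huv⟩
      filter_upwards [mem_nhdsWithin_of_mem_nhds (γ.continuous.continuousAt.eventually (loc (γ t)))]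
        with s hs
      refine ⟨fun hst => hs.trans (hvar hst), fun hts => ?_⟩
      rw [edist_comm]
      exact hs.trans (edist_comm (γ s) (γ t) ▸ hvar hts)
  rw [γ.source, γ.target] at h
  exact h.trans (eVariationOn.mono _ (subset_univ _))

end Length

theorem LocalGeodesicBicombing.IsLocallyConsistent.exists_hasSpeed {X : Type*} [MetricSpace X]
    {σ : LocalGeodesicBicombing X} {c : unitInterval → X} (hc : σ.IsLocallyConsistent c) :
    ∃ w, HasSpeed c w := by
  refine HasSpeedAt.exists_hasSpeed fun t => ?_
  have hball := hc.1.continuousAt.eventually (isOpen_ball.mem_nhds (σ.mem_ball_self (c t)))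
  have hloc := (hc.2 t).and (hball.prod_nhds hball)
  rw [nhds_prod_eq] at hloc
  obtain ⟨V, hV, hloc⟩ := mem_prod_same_iff.1 hloc
  obtain ⟨a, b, hta, hab, hsub⟩ := exists_Icc_mem_subset_of_mem_nhds hV
  have hle : a ≤ b := hta.1.trans hta.2
  obtain ⟨hseg, hda, hdb⟩ :=
    hloc (mk_mem_prod (hsub (left_mem_Icc.2 hle)) (hsub (right_mem_Icc.2 hle)))
  have hdom := mem_localDomain hda hdb
  refine ⟨dist (c a) (c b) / dist a b, ?_⟩
  filter_upwards [prod_mem_nhds hab hab] with p hp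
  obtain ⟨s, hs⟩ := exists_convexComb_eq hp.1
  obtain ⟨s', hs'⟩ := exists_convexComb_eq hp.2
  rw [← hs, ← hs', hseg hle, hseg hle, (σ.isGeodesic _ _ hdom).2, σ.source _ _ hdom,
    σ.target _ _ hdom, dist_convexComb, ← mul_assoc, div_mul_cancel_of_imp fun h => by
      rw [dist_eq_zero.1 h, dist_self], mul_comm, Subtype.dist_eq s, Real.dist_eq]

/-! ### Locally consistent curves between two points -/

theorem IsGeodesic.of_dist_eq {X : Type*} {_ : MetricSpace X} {c : unitInterval → X}
    (h : ∀ s t : unitInterval, dist (c s) (c t) = |(s : ℝ) - t| * dist (c 0) (c 1)) :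
    IsGeodesic c := by
  have hlip : LipschitzWith (nndist (c 0) (c 1)) c := LipschitzWith.of_dist_le_mul fun s t => by
    rw [h, mul_comm, coe_nndist, Subtype.dist_eq, Real.dist_eq]
  exact ⟨hlip.continuous, h⟩

theorem HasConvexDist.of_dist_le {X : Type*} {_ : MetricSpace X} {c c' : unitInterval → X}
    (h : ∀ a b s : unitInterval, a ≤ b →
      dist (c (Icc.convexComb a b s)) (c' (Icc.convexComb a b s)) ≤
        (1 - s) * dist (c a) (c' a) + s * dist (c b) (c' b)) : HasConvexDist c c' := by
  refine LinearOrder.convexOn_of_lt (convex_Icc 0 1) fun u hu v hv huv a b ha hb hab => ?_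
  obtain rfl : a = 1 - b := eq_sub_of_add_eq hab
  let s : unitInterval := ⟨b, hb.le, sub_nonneg.1 ha.le⟩
  let u' : unitInterval := ⟨u, hu⟩
  let v' : unitInterval := ⟨v, hv⟩
  have hcomb : (1 - b) • u + b • v = Icc.convexComb u' v' s := (Icc.coe_convexComb u' v' s).symm
  rw [hcomb, IccExtend_val, IccExtend_of_mem zero_le_one _ hu, IccExtend_of_mem zero_le_one _ hv]
  exact h u' v' s huv.le

theorem continuous_of_isGeodesic_inducedLengthMetric {X : Type*} [MetricSpace X]
    {h : ∀ x y : X, inducedLengthEDist x y ≠ ⊤} {c : unitInterval → X}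
    (hc : @IsGeodesic X (inducedLengthMetric X h) c) : Continuous c := by
  let K : NNReal := (inducedLengthEDist (c 0) (c 1)).toNNReal
  refine (LipschitzWith.of_dist_le_mul (K := K) fun s t => ?_).continuous
  calc dist (c s) (c t) ≤ (inducedLengthEDist (c s) (c t)).toReal := by
        rw [dist_edist]
        exact ENNReal.toReal_mono (h _ _) (edist_le_inducedLengthEDist _ _)
    _ = |(s : ℝ) - t| * K := hc.2 s t
    _ = K * dist s t := by rw [mul_comm, Subtype.dist_eq, Real.dist_eq]

namespace LocalGeodesicBicombing

variable {X : Type*} [MetricSpace X] {σ : LocalGeodesicBicombing X}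

theorem IsConsistent.isLocallyConsistent {c : unitInterval → X} (h : σ.IsConsistent c)
    (hc : Continuous c) : σ.IsLocallyConsistent c := by
  refine ⟨hc, fun t => ?_⟩
  have hb := hc.continuousAt.eventually (isOpen_ball.mem_nhds (σ.mem_ball_self (c t)))
  filter_upwards [hb.prod_nhds hb] with p hp hle s
  exact h p.1 p.2 hle (mem_localDomain hp.1 hp.2) s

variable [CompleteSpace X] [SimplyConnectedSpace X]

namespace IsConvex

theorem eq_of_endpoints (hσ : σ.IsConvex) {c c' : unitInterval → X} (hc : σ.IsLocallyConsistent c)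
    (hc' : σ.IsLocallyConsistent c') (h₀ : c 0 = c' 0) (h₁ : c 1 = c' 1) : c = c' := by
  let e : σ.CurvesFrom (c' 0) := ⟨⟨c, hc.1⟩, hc, h₀⟩
  let e' : σ.CurvesFrom (c' 0) := ⟨⟨c', hc'.1⟩, hc', rfl⟩
  have h : e = e' := (hσ.bijective_endpoint (c' 0)).1 h₁
  exact congrArg (fun e : σ.CurvesFrom (c' 0) => ⇑e.1) h

theorem exists_curve (hσ : σ.IsConvex) (x y : X) :
    ∃ c, σ.IsLocallyConsistent c ∧ c 0 = x ∧ c 1 = y :=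
  have ⟨c, hc⟩ := (hσ.bijective_endpoint x).2 y
  ⟨c.1, c.2.1, c.2.2, hc⟩

/-- The unique locally consistent curve from `x` to `y`. -/
noncomputable def curve (hσ : σ.IsConvex) (x y : X) : unitInterval → X :=
  (hσ.exists_curve x y).choose

theorem isLocallyConsistent_curve (hσ : σ.IsConvex) (x y : X) :
    σ.IsLocallyConsistent (hσ.curve x y) :=
  (hσ.exists_curve x y).choose_spec.1

theorem continuous_curve (hσ : σ.IsConvex) (x y : X) : Continuous (hσ.curve x y) :=
  (hσ.isLocallyConsistent_curve x y).1

@[simp]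
theorem curve_zero (hσ : σ.IsConvex) (x y : X) : hσ.curve x y 0 = x :=
  (hσ.exists_curve x y).choose_spec.2.1

@[simp]
theorem curve_one (hσ : σ.IsConvex) (x y : X) : hσ.curve x y 1 = y :=
  (hσ.exists_curve x y).choose_spec.2.2

theorem curve_eq (hσ : σ.IsConvex) {c : unitInterval → X} (hc : σ.IsLocallyConsistent c) {x y : X}
    (h₀ : c 0 = x) (h₁ : c 1 = y) : hσ.curve x y = c :=
  hσ.eq_of_endpoints (hσ.isLocallyConsistent_curve x y) hc (by rw [curve_zero, h₀])
    (by rw [curve_one, h₁])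

theorem curve_self (hσ : σ.IsConvex) (x : X) : hσ.curve x x = fun _ => x :=
  hσ.curve_eq (σ.isLocallyConsistent_const x) rfl rfl

theorem curve_convexComb (hσ : σ.IsConvex) (x y : X) {a b : unitInterval} (hab : a ≤ b) :
    hσ.curve (hσ.curve x y a) (hσ.curve x y b) = fun t => hσ.curve x y (Icc.convexComb a b t) :=
  hσ.curve_eq ((hσ.isLocallyConsistent_curve x y).comp_convexComb hab)
    (by rw [Icc.convexComb_zero]) (by rw [Icc.convexComb_one])

theorem isConsistent_curve (hσ : σ.IsConvex) (x y : X) : σ.IsConsistent (hσ.curve x y) := by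
  intro a b hab hdom t
  have h := hσ.curve_eq (isLocallyConsistent_seg hdom) (σ.source _ _ hdom) (σ.target _ _ hdom)
  rw [hσ.curve_convexComb x y hab] at h
  exact congrFun h t

theorem curve_comp_symm (hσ : σ.IsConvex) (hr : σ.IsReversible) (x y : X) :
    hσ.curve y x = hσ.curve x y ∘ unitInterval.symm :=
  hσ.curve_eq ((hσ.isLocallyConsistent_curve x y).symm hr)
    (by rw [unitInterval.symm_zero, curve_one]) (by rw [unitInterval.symm_one, curve_zero])

theorem contractibleSpace (hσ : σ.IsConvex) : ContractibleSpace X := by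
  obtain ⟨x₀⟩ : Nonempty X := inferInstance
  let e := (hσ.isLocalIsometry_endpoint x₀).isLocalHomeomorph.toHomeomorphOfBijective
    (hσ.bijective_endpoint x₀)
  have hcont : Continuous fun q : unitInterval × X => (e.symm q.2).1 q.1 :=
    (continuous_subtype_val.comp (e.symm.continuous.comp continuous_snd)).eval continuous_fst
  rw [contractible_iff_id_nullhomotopic]
  exact ⟨x₀, ContinuousMap.Homotopic.symm ⟨⟨⟨_, hcont⟩, fun x => (e.symm x).2.2,
    fun x => e.apply_symm_apply x⟩⟩⟩

theorem exists_dist_curve_le (hσ : σ.IsConvex) (y z : X) : ∃ ε > 0, ∀ y' z',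
    dist y' y ≤ ε → dist z' z ≤ ε → ∀ t : unitInterval,
      dist (hσ.curve y' z' t) (hσ.curve y z t) ≤ (1 - t) * dist y' y + t * dist z' z := by
  obtain ⟨ε, hε, -, h⟩ := (hσ.isLocallyConsistent_curve y z).exists_deformation hσ
  simp only [curve_zero, curve_one] at h
  refine ⟨ε, hε, fun y' z' hy hz => ?_⟩
  obtain ⟨c', hc', h₀, h₁, hdist⟩ := h y' z' hy hz
  rwa [hσ.curve_eq hc' h₀ h₁]

/-- The speed of the locally consistent curve from `x` to `y`, which is the induced length distance
of `x` and `y`. -/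
noncomputable def speed (hσ : σ.IsConvex) (x y : X) : ℝ :=
  (hσ.isLocallyConsistent_curve x y).exists_hasSpeed.choose

theorem hasSpeed_curve (hσ : σ.IsConvex) (x y : X) : HasSpeed (hσ.curve x y) (hσ.speed x y) :=
  (hσ.isLocallyConsistent_curve x y).exists_hasSpeed.choose_spec

theorem speed_nonneg (hσ : σ.IsConvex) (x y : X) : 0 ≤ hσ.speed x y :=
  (hσ.hasSpeed_curve x y).nonneg

theorem speed_self (hσ : σ.IsConvex) (x : X) : hσ.speed x x = 0 :=
  (hσ.hasSpeed_curve x x).unique (hσ.curve_self x ▸ hasSpeed_const x)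

theorem eventually_dist_speed_le (hσ : σ.IsConvex) (x y : X) :
    ∀ᶠ z in 𝓝 y, dist (hσ.speed x z) (hσ.speed x y) ≤ dist z y := by
  obtain ⟨ε, hε, h⟩ := hσ.exists_dist_curve_le x y
  filter_upwards [closedBall_mem_nhds y hε] with z hz
  have hx : dist x x ≤ ε := (dist_self x).trans_le hε.le
  refine (hσ.hasSpeed_curve x z 0).abs_sub_le (hσ.hasSpeed_curve x y 0)
    (by rw [curve_zero, curve_zero]) fun s => (h x z hx hz s).trans_eq ?_
  rw [dist_self, mul_zero, zero_add, mul_comm, Subtype.dist_eq, Real.dist_eq, Icc.coe_zero,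
    sub_zero, abs_of_nonneg s.2.1]

theorem inducedLengthEDist_eq (hσ : σ.IsConvex) (x y : X) :
    inducedLengthEDist x y = ENNReal.ofReal (hσ.speed x y) := by
  refine le_antisymm ?_ ?_
  · let γ : Path x y := ⟨⟨hσ.curve x y, hσ.continuous_curve x y⟩, hσ.curve_zero x y,
      hσ.curve_one x y⟩
    exact (iInf_le _ γ).trans
      (curveLength_le_of_lipschitzWith γ (hσ.hasSpeed_curve x y).lipschitzWith)
  · have h := edist_le_inducedLengthEDist_of_eventually (f := hσ.speed x) (fun y =>
      (hσ.eventually_dist_speed_le x y).mono fun z hz => by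
        rw [edist_dist, edist_dist]
        exact ENNReal.ofReal_le_ofReal hz) x y
    rwa [hσ.speed_self, edist_dist, dist_zero_left, Real.norm_of_nonneg (hσ.speed_nonneg x y)] at h

theorem inducedLengthEDist_ne_top (hσ : σ.IsConvex) (x y : X) : inducedLengthEDist x y ≠ ⊤ :=
  hσ.inducedLengthEDist_eq x y ▸ ENNReal.ofReal_ne_top

theorem dist_inducedLengthMetric (hσ : σ.IsConvex) (h : ∀ x y : X, inducedLengthEDist x y ≠ ⊤)
    (x y : X) : @dist X (inducedLengthMetric X h).toDist x y = hσ.speed x y := by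
  rw [inducedLengthMetric_dist, hσ.inducedLengthEDist_eq,
    ENNReal.toReal_ofReal (hσ.speed_nonneg x y)]

theorem eq_of_speed_eq_zero (hσ : σ.IsConvex) {x y : X} (h : hσ.speed x y = 0) : x = y :=
  edist_le_zero.1 <| (edist_le_inducedLengthEDist x y).trans_eq <| by
    rw [hσ.inducedLengthEDist_eq, h, ENNReal.ofReal_zero]

theorem speed_comm (hσ : σ.IsConvex) (x y : X) : hσ.speed x y = hσ.speed y x := by
  rw [← ENNReal.ofReal_eq_ofReal_iff (hσ.speed_nonneg x y) (hσ.speed_nonneg y x),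
    ← hσ.inducedLengthEDist_eq, ← hσ.inducedLengthEDist_eq]
  exact le_antisymm (inducedLengthEDist_comm_le x y) (inducedLengthEDist_comm_le y x)

theorem speed_curve (hσ : σ.IsConvex) (x y : X) (s t : unitInterval) :
    hσ.speed (hσ.curve x y s) (hσ.curve x y t) = |(s : ℝ) - t| * hσ.speed x y := by
  wlog hst : s ≤ t generalizing s t
  · rw [hσ.speed_comm, abs_sub_comm]
    exact this t s (le_of_not_ge hst)
  have h := (hσ.hasSpeed_curve x y).comp_convexComb s t
  rw [← hσ.curve_convexComb x y hst] at h
  rw [(hσ.hasSpeed_curve _ _).unique h, mul_comm, Subtype.dist_eq, Real.dist_eq]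

theorem speed_curve_curve_le (hσ : σ.IsConvex) (x y x' y' : X) (t : unitInterval) :
    hσ.speed (hσ.curve x y t) (hσ.curve x' y' t) ≤
      (1 - t) * hσ.speed x x' + t * hσ.speed y y' := by
  set K : ℝ := (1 - t) * hσ.speed x x' + t * hσ.speed y y' with hKdef
  have ht : (0 : ℝ) ≤ 1 - t := sub_nonneg.2 t.2.2
  have hK : 0 ≤ K :=
    add_nonneg (mul_nonneg ht (hσ.speed_nonneg _ _)) (mul_nonneg t.2.1 (hσ.speed_nonneg _ _))
  -- Move `x` to `x'` and `y` to `y'` along their curves; the point at time `t` moves with speed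
  -- at most `K`.
  let F : unitInterval → X := fun s => hσ.curve (hσ.curve x x' s) (hσ.curve y y' s) t
  have hF : LipschitzWith K.toNNReal F := lipschitzWith_of_eventually_dist_le fun s => by
    obtain ⟨ε, hε, h⟩ := hσ.exists_dist_curve_le (hσ.curve x x' s) (hσ.curve y y' s)
    have hnear (p q : X) : ∀ᶠ u in 𝓝 s, dist (hσ.curve p q u) (hσ.curve p q s) ≤ ε :=
      (hσ.continuous_curve p q).continuousAt.eventually (closedBall_mem_nhds _ hε)
    filter_upwards [hnear x x', hnear y y', (hσ.hasSpeed_curve x x' s).eventually_dist_eq,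
      (hσ.hasSpeed_curve y y' s).eventually_dist_eq] with u hx hy hxdist hydist
    refine (h _ _ hx hy t).trans_eq ?_
    rw [hxdist, hydist, Real.coe_toNNReal K hK, hKdef]
    ring
  let γ : Path (hσ.curve x y t) (hσ.curve x' y' t) :=
    ⟨⟨F, hF.continuous⟩, by simp only [F, curve_zero], by simp only [F, curve_one]⟩
  rw [← ENNReal.ofReal_le_ofReal_iff hK, ← hσ.inducedLengthEDist_eq]
  exact (iInf_le _ γ).trans (curveLength_le_of_lipschitzWith γ hF)

theorem range_curve_subset (hσ : σ.IsConvex) {x y p q : X} (hp : p ∈ range (hσ.curve x y))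
    (hq : q ∈ range (hσ.curve x y)) (h : hσ.speed x p ≤ hσ.speed x q) :
    range (hσ.curve p q) ⊆ range (hσ.curve x y) := by
  obtain ⟨a, rfl⟩ := hp
  obtain ⟨b, rfl⟩ := hq
  rcases (hσ.speed_nonneg x y).eq_or_lt with hzero | hpos
  · obtain rfl := hσ.eq_of_speed_eq_zero hzero.symm
    simp only [curve_self, subset_rfl]
  · have hx (t : unitInterval) : hσ.speed x (hσ.curve x y t) = t * hσ.speed x y := by
      simpa only [curve_zero, Icc.coe_zero, zero_sub, abs_neg, abs_of_nonneg t.2.1] using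
        hσ.speed_curve x y 0 t
    rw [hx, hx] at h
    have hab : a ≤ b := Subtype.coe_le_coe.1 (le_of_mul_le_mul_right h hpos)
    rw [hσ.curve_convexComb x y hab]
    exact range_comp_subset_range _ _

theorem isConvexGeodesicBicombing_curve (hσ : σ.IsConvex)
    (h : ∀ x y : X, inducedLengthEDist x y ≠ ⊤) :
    @IsConvexGeodesicBicombing X (inducedLengthMetric X h) hσ.curve := by
  have hdist := hσ.dist_inducedLengthMetric h
  refine @IsConvexGeodesicBicombing.mk X (inducedLengthMetric X h) _
    (@IsGeodesicBicombing.mk X (inducedLengthMetric X h) _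
      (fun x y => .of_dist_eq fun s t => ?_) hσ.curve_zero hσ.curve_one
      fun x y p q hp hq hpq => ?_)
    fun x y x' y' => .of_dist_le fun a b s hab => ?_
  · rw [hdist, hdist, hσ.speed_curve, curve_zero, curve_one]
  · rw [hdist, hdist] at hpq
    exact hσ.range_curve_subset hp hq hpq
  · rw [hdist, hdist, hdist]
    simpa only [hσ.curve_convexComb _ _ hab] using
      hσ.speed_curve_curve_le (hσ.curve x y a) (hσ.curve x y b) (hσ.curve x' y' a)
        (hσ.curve x' y' b) s

end IsConvex

end LocalGeodesicBicombing

theorem theorem1p1 {X : Type*} [MetricSpace X] [CompleteSpace X] [SimplyConnectedSpace X]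
    (σ : LocalGeodesicBicombing X) (hσ : σ.IsConvex) :
    (∃ h : ∀ x y : X, inducedLengthEDist x y ≠ ⊤,
      ∃ τ : X → X → unitInterval → X,
        (@IsConvexGeodesicBicombing X (inducedLengthMetric X h) τ ∧
          ∀ x y, σ.IsConsistent (τ x y)) ∧
        (∀ τ' : X → X → unitInterval → X,
          @IsConvexGeodesicBicombing X (inducedLengthMetric X h) τ' →
          (∀ x y, σ.IsConsistent (τ' x y)) → τ' = τ) ∧
        (σ.IsReversible → IsReversibleBicombing τ)) ∧
    ContractibleSpace X := by
  refine ⟨⟨hσ.inducedLengthEDist_ne_top, hσ.curve,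
    ⟨hσ.isConvexGeodesicBicombing_curve _, hσ.isConsistent_curve⟩, fun τ' hτ' hcon => ?_,
    fun hr x y => ?_⟩, hσ.contractibleSpace⟩
  · obtain ⟨⟨hgeodesic, hsource, htarget, -⟩, -⟩ := hτ'
    funext x y
    have hcont := continuous_of_isGeodesic_inducedLengthMetric (hgeodesic x y)
    exact (hσ.curve_eq ((hcon x y).isLocallyConsistent hcont) (hsource x y) (htarget x y)).symm
  · rw [hσ.curve_comp_symm hr, unitInterval.symm_bijective.surjective.range_comp]
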